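/- Work on $\mathbb{R}^2$ with $\hat f(\xi)=\int e^{-2\pi i x\cdot\xi}f(x)\,dx$, extended to tempered distributions. For $\sigma\in\mathbb{R}$ let $\mathcal F(\Lambda^\sigma f)=|\xi|^\sigma\hat f$, $\|f\|_{\dot H^\sigma}=\||\xi|^\sigma\hat f\|_{L^2}$, and let $\dot H^\sigma$ be the set of tempered distributions $f$ with $\hat f\in L^2_{loc}(\mathbb{R}^2)$ and $\|f\|_{\dot H^\sigma}<\infty$; let $W$ be the set of tempered distributions $f$ with $\hat f\in L^1$. Norms of $\hat f$, $|\xi|^\sigma\hat f$ that are not finite are $+\infty$. Fix a non-negative radial Schwartz function $\phi$ with $\operatorname{supp}\phi\subset\{\tfrac12<|\xi|<2\}$ and $\sum_{j\in\mathbb{Z}}\phi(2^{-j}\xi)=1$ for $\xi\neq0$; let $\mathcal F(\triangle_jf)=\phi(2^{-j}\xi)\hat f$ and $\mathcal A_j=\{2^{j-1}<|\xi|<2^{j+1}\}$. Write $[T,g]f=T(gf)-g\,Tf$ and $\langle u,h\rangle=\int u\,\overline{h}\,dx$. Let $s\in[0,1)$, $\nu\in(0,1)$, $\rho\in\mathbb{R}$.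 There is a constant $C>0$, depending only on $s,\nu,\rho$ (and on the fixed function $\phi$), such that the following holds. Let $P$ be a complex-valued function, differentiable on $\mathbb{R}^2\setminus\{0\}$, and $M\ge 0$ with $|P(\xi)|\le M$ and $|\xi|\,|\nabla P(\xi)|\le M$ for all $\xi\ne0$; let $P(D)$ be the Fourier multiplier with symbol $P$. Let $\mathscr D=\Lambda$ or $\mathscr D=\partial_\ell$ with $\ell\in\{1,2\}$. Suppose that either $$(f,g)\in(\dot H^{1-\nu}\times\dot H^{s+1})\cup(\dot H^s\times\dot H^{2-\nu})$$ or $$(f,\Lambda g)\in\big((W\cap\dot H^1)\times\dot H^s\big)\cup\big(\dot H^s\times(W\cap\dot H^1)\big),$$ where $\hat g$ is a locally integrable function. Then there is a sequence $(c_j)_{j\in\mathbb{Z}}$ of non-negative numbers with $\sum_jc_j^2\le1$ such that, for every $j\in\mathbb{Z}$ and every $h\in\dot H^{\rho}$ with $\hat h$ supported in $\mathcal A_j$, the pairing $\langle[\Lambda^{s+\rho}P(D)\mathscr D\triangle_j,g]f,h\rangle$ is well defined and satisfies both $$|\langle[\Lambda^{s+\rho}P(D)\mathscr D\triangle_j,g]f,h\rangle|\le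 CMc_j\min\big\{\|f\|_{\dot H^{1-\nu}}\|g\|_{\dot H^{s+1}},\ \|f\|_{\dot H^s}\|g\|_{\dot H^{2-\nu}}\big\}\|h\|_{\dot H^{\rho+\nu}}$$ and $$|\langle[\Lambda^{s+\rho}P(D)\mathscr D\triangle_j,g]f,h\rangle|\le CMc_j\min\big\{(\|\hat f\|_{L^1}+\|f\|_{\dot H^1})\|g\|_{\dot H^{s+1}},\ (\|\widehat{\Lambda g}\|_{L^1}+\|g\|_{\dot H^2})\|f\|_{\dot H^s}\big\}\|h\|_{\dot H^{\rho}}.$$ -/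

import Mathlib

open MeasureTheory FourierTransform
open scoped SchwartzMap ENNReal NNReal ComplexConjugate

namespace LocCommutator

/-- The Euclidean plane `ℝ²`. -/
abbrev Plane : Type := EuclideanSpace ℝ (Fin 2)

/-- The tempered distribution `T` is (integration against) the function `u`. Such a `u` is
locally integrable and determined by `T` up to a null set. -/
def Represents (u : Plane → ℂ) (T : 𝓢'(Plane, ℂ)) : Prop :=
  ∀ θ : 𝓢(Plane, ℂ), Integrable (fun x => u x * θ x) ∧ T θ = ∫ x, u x * θ x

/-- `‖ |ξ|^σ 𝓕T ‖_{L^p}`, with value `∞` if `𝓕T` is not a function. The infimum runs over the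
almost everywhere equal representatives of `𝓕T`. -/
noncomputable def fourierNorm (p : ℝ≥0∞) (σ : ℝ) (T : 𝓢'(Plane, ℂ)) : ℝ≥0∞ :=
  ⨅ (w : Plane → ℂ) (_ : Represents w (𝓕 T)),
    eLpNorm (fun ξ => ((‖ξ‖ ^ σ : ℝ) : ℂ) * w ξ) p volume

/-- The homogeneous Sobolev norm `‖T‖_{Ḣ^σ} = ‖ |ξ|^σ 𝓕T ‖_{L²}`. -/
noncomputable def hdotNorm (σ : ℝ) (T : 𝓢'(Plane, ℂ)) : ℝ≥0∞ := fourierNorm 2 σ T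

/-- `T ∈ Ḣ^σ(ℝ²)`: the Fourier transform of `T` is a function in `L²_loc(ℝ²)` and
`‖T‖_{Ḣ^σ} < ∞`. -/
def MemHdot (σ : ℝ) (T : 𝓢'(Plane, ℂ)) : Prop :=
  (∃ w : Plane → ℂ, Represents w (𝓕 T) ∧
    ∀ K : Set Plane, IsCompact K → MemLp w 2 (volume.restrict K)) ∧ hdotNorm σ T < ∞

/-- `T ∈ W(ℝ²)`: the Fourier transform of `T` belongs to `L¹(ℝ²)`. -/
def MemW (T : 𝓢'(Plane, ℂ)) : Prop :=
  ∃ w : Plane → ℂ, Represents w (𝓕 T) ∧ Integrable w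

/-- `S = m(D) T`, i.e. `𝓕S = m 𝓕T`, where `𝓕T` is a function. -/
def IsMultiplier (m : Plane → ℂ) (T S : 𝓢'(Plane, ℂ)) : Prop :=
  ∃ w : Plane → ℂ, Represents w (𝓕 T) ∧ Represents (fun ξ => m ξ * w ξ) (𝓕 S)

/-- `S = T₁ T₂`, the pointwise product of the functions `T₁` and `T₂`. -/
def IsProduct (T₁ T₂ S : 𝓢'(Plane, ℂ)) : Prop :=
  ∃ u v : Plane → ℂ, Represents u T₁ ∧ Represents v T₂ ∧ Represents (fun x => u x * v x) S

/-- `K = [m(D), g] f = m(D)(g f) - g (m(D) f)`, all the terms being well defined. -/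
def IsCommutator (m : Plane → ℂ) (g f K : 𝓢'(Plane, ℂ)) : Prop :=
  ∃ gf A mf B : 𝓢'(Plane, ℂ), IsProduct g f gf ∧ IsMultiplier m gf A ∧
    IsMultiplier m f mf ∧ IsProduct g mf B ∧ K = A - B

/-- `z = ⟨K, h⟩ = ∫ K(x) conj(h(x)) dx`, an absolutely convergent integral. -/
def IsPairing (K h : 𝓢'(Plane, ℂ)) (z : ℂ) : Prop :=
  ∃ k η : Plane → ℂ, Represents k K ∧ Represents η h ∧
    Integrable (fun x => k x * conj (η x)) ∧ z = ∫ x, k x * conj (η x)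

/-- The symbol `|ξ|^σ` of `Λ^σ`. -/
noncomputable def lamSymbol (σ : ℝ) (ξ : Plane) : ℂ := ((‖ξ‖ ^ σ : ℝ) : ℂ)

/-- The symbol `2πi ξ_ℓ` of `∂_ℓ` (for the Fourier transform with kernel `e^{-2πi x·ξ}`). -/
noncomputable def partialSymbol (l : Fin 2) (ξ : Plane) : ℂ :=
  2 * Real.pi * Complex.I * (ξ l : ℂ)

/-- The open dyadic annulus `𝒜_j = {2^{j-1} < |ξ| < 2^{j+1}}`. -/
def annulus (j : ℤ) : Set Plane := {ξ | (2 : ℝ) ^ (j - 1) < ‖ξ‖ ∧ ‖ξ‖ < (2 : ℝ) ^ (j + 1)}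

/-- `φ` generates a homogeneous Littlewood-Paley decomposition: it is a non-negative radial
Schwartz function with support in `𝒜_0`, and `∑_j φ(2^{-j} ξ) = 1` for `ξ ≠ 0`. -/
structure IsLittlewoodPaley (φ : 𝓢(Plane, ℝ)) : Prop where
  nonneg : ∀ ξ, 0 ≤ φ ξ
  radial : ∀ ξ ζ : Plane, ‖ξ‖ = ‖ζ‖ → φ ξ = φ ζ
  support : tsupport φ ⊆ annulus 0
  sum_eq_one : ∀ ξ : Plane, ξ ≠ 0 → HasSum (fun j : ℤ => φ ((2 : ℝ) ^ (-j) • ξ)) 1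

/-- The symbol `φ(2^{-j} ξ)` of the dyadic block `Δ_j`. -/
noncomputable def blockSymbol (φ : 𝓢(Plane, ℝ)) (j : ℤ) (ξ : Plane) : ℂ :=
  (φ ((2 : ℝ) ^ (-j) • ξ) : ℂ)

/-- The symbol of `Λ^a P(D) 𝒟 Δ_j`, where `d` is the symbol of `𝒟`. -/
noncomputable def opSymbol (φ : 𝓢(Plane, ℝ)) (a : ℝ) (P d : Plane → ℂ) (j : ℤ) (ξ : Plane) : ℂ :=
  lamSymbol a ξ * P ξ * d ξ * blockSymbol φ j ξ

/-- `P` is differentiable off the origin with `|P(ξ)| ≤ M` and `|ξ| |∇P(ξ)| ≤ M` there. -/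
structure SymbolBound (P : Plane → ℂ) (M : ℝ≥0) : Prop where
  diff : ∀ ξ : Plane, ξ ≠ 0 → DifferentiableAt ℝ P ξ
  bound : ∀ ξ : Plane, ξ ≠ 0 → ‖P ξ‖ ≤ M
  gradient_bound : ∀ ξ : Plane, ξ ≠ 0 → ‖ξ‖ * ‖fderiv ℝ P ξ‖ ≤ M

/-- `𝓕h` is a function that vanishes (almost everywhere) outside `S`. -/
def FourierSupportedIn (h : 𝓢'(Plane, ℂ)) (S : Set Plane) : Prop :=
  ∃ w : Plane → ℂ, Represents w (𝓕 h) ∧ ∀ᵐ ξ, ξ ∉ S → w ξ = 0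

/-- The admissible pairs `(f, g)`: either
`(f, g) ∈ (Ḣ^{1-ν} × Ḣ^{s+1}) ∪ (Ḣ^s × Ḣ^{2-ν})` or
`(f, Λg) ∈ ((W ∩ Ḣ¹) × Ḣ^s) ∪ (Ḣ^s × (W ∩ Ḣ¹))`. -/
def Admissible (s ν : ℝ) (f g : 𝓢'(Plane, ℂ)) : Prop :=
  ((MemHdot (1 - ν) f ∧ MemHdot (s + 1) g) ∨ (MemHdot s f ∧ MemHdot (2 - ν) g)) ∨
  ∃ G : 𝓢'(Plane, ℂ), IsMultiplier (lamSymbol 1) g G ∧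
    (((MemW f ∧ MemHdot 1 f) ∧ MemHdot s G) ∨ (MemHdot s f ∧ (MemW G ∧ MemHdot 1 G)))

end LocCommutator

namespace LocCommutator

/-- The weight `|ξ|^σ` with values in `[0, ∞]`. -/
noncomputable def wt (σ : ℝ) (ξ : Plane) : ℝ≥0∞ := ENNReal.ofReal (‖ξ‖ ^ σ)

@[fun_prop]
lemma measurable_wt (σ : ℝ) : Measurable (wt σ) := by
  unfold wt; fun_prop

lemma wt_add {ξ : Plane} (hξ : ξ ≠ 0) (σ τ : ℝ) : wt (σ + τ) ξ = wt σ ξ * wt τ ξ := by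
  rw [wt, wt, wt, Real.rpow_add (norm_pos_iff.2 hξ), ENNReal.ofReal_mul (by positivity)]

@[simp]
lemma wt_zero (ξ : Plane) : wt 0 ξ = 1 := by simp [wt]

lemma wt_sq (σ : ℝ) (ξ : Plane) : wt σ ξ ^ 2 = wt (2 * σ) ξ := by
  rw [wt, wt, ← ENNReal.ofReal_pow (by positivity), ← Real.rpow_mul_natCast (norm_nonneg _)]
  congr 2; push_cast; ring

lemma wt_neg_mul {ξ : Plane} (hξ : ξ ≠ 0) (σ : ℝ) : wt (-σ) ξ * wt σ ξ = 1 := by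
  rw [← wt_add hξ]; simp

lemma rpow_le_of_comparable {x y K : ℝ} (hx : 0 ≤ x) (hy : 0 ≤ y) (hK : 1 ≤ K) (c : ℝ)
    (hxy : x ≤ K * y) (hyx : y ≤ K * x) : x ^ c ≤ K ^ |c| * y ^ c := by
  have hK0 : 0 < K := by linarith
  rcases le_or_gt 0 c with hc | hc
  · rw [abs_of_nonneg hc, ← Real.mul_rpow hK0.le hy]
    exact Real.rpow_le_rpow hx hxy hc
  · rcases hy.eq_or_lt with rfl | hy
    · have : x = 0 := by linarith
      rw [this, Real.zero_rpow hc.ne]; simp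
    · have hx' : 0 < x := by
        by_contra h
        have : x = 0 := by linarith
        rw [this] at hyx; linarith
      have h1 : x ^ c ≤ (K⁻¹ * y) ^ c := by
        apply Real.rpow_le_rpow_of_nonpos (by positivity) _ hc.le
        rw [inv_mul_le_iff₀ hK0]; exact hyx
      rwa [Real.mul_rpow (by positivity) hy.le, Real.inv_rpow hK0.le, ← Real.rpow_neg hK0.le,
        ← abs_of_neg hc] at h1

lemma wt_le_of_comparable {x y : Plane} {K : ℝ} (hK : 1 ≤ K) (c : ℝ)
    (hxy : ‖x‖ ≤ K * ‖y‖) (hyx : ‖y‖ ≤ K * ‖x‖) :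
    wt c x ≤ ENNReal.ofReal (K ^ |c|) * wt c y := by
  rw [wt, wt, ← ENNReal.ofReal_mul (by positivity)]
  exact ENNReal.ofReal_le_ofReal
    (rpow_le_of_comparable (norm_nonneg _) (norm_nonneg _) hK c hxy hyx)

lemma lintegral_wt_unitBall_lt_top {p : ℝ} (hp : -2 < p) :
    ∫⁻ ξ in Metric.closedBall (0 : Plane) 1, wt p ξ < ∞ := by
  have h : IntegrableOn (fun ξ : Plane => ‖ξ‖ ^ p) (Metric.ball 0 2) := by
    refine integrableOn_ball_of_norm_le_rpow (C := 1) (α := -p) ?_ ?_ ?_ ?_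
    · simp
    · simp only [finrank_euclideanSpace_fin]; push_cast; linarith
    · refine Filter.Eventually.of_forall fun x => ?_
      rw [Real.norm_of_nonneg (by positivity)]; simp
    · exact (measurable_norm.pow_const p).aestronglyMeasurable
  have h' := h.mono_set (Metric.closedBall_subset_ball (by norm_num : (1:ℝ) < 2))
  refine lt_of_le_of_lt (lintegral_mono fun ξ => ?_) h'.2
  rw [wt, ← ofReal_norm, Real.norm_of_nonneg (by positivity)]

lemma lintegral_comp_smul_plane {R : ℝ} (hR : 0 < R) {f : Plane → ℝ≥0∞} (hf : Measurable f) :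
    ∫⁻ ξ, f ξ = ENNReal.ofReal (R ^ 2) * ∫⁻ ξ, f (R • ξ) := by
  have h := Measure.map_addHaar_smul (volume : Measure Plane) hR.ne'
  have h2 : ∫⁻ ξ, f (R • ξ) = ∫⁻ ξ, f ξ ∂(Measure.map (R • ·) volume) :=
    (lintegral_map hf (measurable_const_smul R)).symm
  rw [h2, h, lintegral_smul_measure, finrank_euclideanSpace_fin, smul_eq_mul, ← mul_assoc,
    ← ENNReal.ofReal_mul (by positivity), abs_of_pos (by positivity),
    mul_inv_cancel₀ (by positivity)]
  simp

lemma exists_lintegral_wt_ball_le {p : ℝ} (hp : -2 < p) :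
    ∃ C : ℝ≥0, ∀ R : ℝ, 0 ≤ R →
      ∫⁻ ξ in Metric.closedBall (0 : Plane) R, wt p ξ ≤ C * ENNReal.ofReal (R ^ (p + 2)) := by
  refine ⟨(∫⁻ ξ in Metric.closedBall (0 : Plane) 1, wt p ξ).toNNReal, fun R hR => ?_⟩
  rw [ENNReal.coe_toNNReal (lintegral_wt_unitBall_lt_top hp).ne]
  rcases hR.eq_or_lt with rfl | hR
  · simp
  rw [← lintegral_indicator measurableSet_closedBall, lintegral_comp_smul_plane hR
    ((measurable_wt p).indicator measurableSet_closedBall),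
    ← lintegral_indicator measurableSet_closedBall]
  have : ∀ ξ : Plane, (Metric.closedBall (0 : Plane) R).indicator (wt p) (R • ξ)
      = ENNReal.ofReal (R ^ p) * (Metric.closedBall (0 : Plane) 1).indicator (wt p) ξ := by
    intro ξ
    have h1 : R • ξ ∈ Metric.closedBall (0 : Plane) R ↔ ξ ∈ Metric.closedBall (0 : Plane) 1 := by
      simp [norm_smul, abs_of_pos hR, hR]
    by_cases hξ : ξ ∈ Metric.closedBall (0 : Plane) 1
    · rw [Set.indicator_of_mem hξ, Set.indicator_of_mem (h1.2 hξ), wt, wt, norm_smul,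
        Real.norm_of_nonneg hR.le, Real.mul_rpow hR.le (norm_nonneg _),
        ENNReal.ofReal_mul (by positivity)]
    · rw [Set.indicator_of_notMem hξ, Set.indicator_of_notMem (fun h => hξ (h1.1 h)), mul_zero]
  simp_rw [this]
  rw [lintegral_const_mul _ ((measurable_wt p).indicator measurableSet_closedBall), ← mul_assoc,
    ← ENNReal.ofReal_mul (by positivity), mul_comm]
  gcongr
  rw [Real.rpow_add hR, mul_comm]
  norm_num

/-- The Cauchy-Schwarz inequality for lower Lebesgue integrals. -/
lemma sq_lintegral_mul_le {α : Type*} [MeasurableSpace α] {μ : Measure α} {f g : α → ℝ≥0∞}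
    (hf : AEMeasurable f μ) (hg : AEMeasurable g μ) :
    (∫⁻ x, f x * g x ∂μ) ^ 2 ≤ (∫⁻ x, f x ^ 2 ∂μ) * ∫⁻ x, g x ^ 2 ∂μ := by
  have h := ENNReal.lintegral_mul_le_Lp_mul_Lq μ Real.HolderConjugate.two_two hf hg
  have h2 : ∀ x : ℝ≥0∞, (x ^ (1 / (2:ℝ))) ^ 2 = x := fun x => by
    rw [← ENNReal.rpow_mul_natCast]; norm_num
  calc _ ≤ _ := pow_le_pow_left' h 2
    _ = _ := by rw [mul_pow, h2, h2]; norm_cast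

lemma sq_add_le (x y : ℝ≥0∞) : (x + y) ^ 2 ≤ 2 * (x ^ 2 + y ^ 2) := by
  have h := ENNReal.rpow_add_le_mul_rpow_add_rpow x y (p := 2) (by norm_num : (1 : ℝ) ≤ 2)
  norm_num at h
  exact h

lemma ae_ne_zero : ∀ᵐ ξ : Plane, ξ ≠ 0 := by
  simp [ae_iff, measure_singleton]

/-- A Cauchy-Schwarz inequality in which the weight `|η|^b` is moved onto one factor. -/
lemma sq_setLIntegral_mul_le_wt (b : ℝ) {S : Set Plane} {u v : Plane → ℝ≥0∞} (hu : Measurable u)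
    (hv : Measurable v) :
    (∫⁻ η in S, u η * v η) ^ 2
      ≤ (∫⁻ η in S, wt (-(2 * b)) η * u η ^ 2) * ∫⁻ η in S, wt (2 * b) η * v η ^ 2 := by
  have h : ∫⁻ η in S, u η * v η = ∫⁻ η in S, (wt (-b) η * u η) * (wt b η * v η) := by
    refine lintegral_congr_ae (ae_restrict_of_ae ?_)
    filter_upwards [ae_ne_zero] with η hη
    rw [mul_mul_mul_comm, wt_neg_mul hη, one_mul]
  rw [h]
  refine (sq_lintegral_mul_le (by fun_prop) (by fun_prop)).trans_eq ?_
  simp_rw [mul_pow, wt_sq, mul_neg]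

/-- The convolution of two functions with values in `[0, ∞]`. -/
noncomputable def cv (F H : Plane → ℝ≥0∞) (ξ : Plane) : ℝ≥0∞ := ∫⁻ η, F (ξ - η) * H η

@[fun_prop]
lemma measurable_cv {F H : Plane → ℝ≥0∞} (hF : Measurable F) (hH : Measurable H) :
    Measurable (cv F H) := by
  unfold cv
  exact Measurable.lintegral_prod_right' (f := fun p : Plane × Plane => F (p.1 - p.2) * H p.2)
    (by fun_prop)

lemma cv_comm (F H : Plane → ℝ≥0∞) : cv F H = cv H F := by
  ext ξ
  unfold cv
  rw [← lintegral_sub_left_eq_self _ ξ]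
  simp [mul_comm]

lemma lintegral_cv {F H : Plane → ℝ≥0∞} (hF : Measurable F) (hH : Measurable H) :
    ∫⁻ ξ, cv F H ξ = (∫⁻ ξ, F ξ) * ∫⁻ ξ, H ξ := by
  unfold cv
  rw [lintegral_lintegral_swap (by fun_prop)]
  have h : ∀ η, ∫⁻ ξ, F (ξ - η) * H η = (∫⁻ ξ, F ξ) * H η := fun η => by
    rw [lintegral_mul_const _ (by fun_prop), lintegral_sub_right_eq_self F]
  simp_rw [h]
  rw [lintegral_const_mul _ hH]

lemma sq_cv_le {F H : Plane → ℝ≥0∞} (hF : Measurable F) (hH : Measurable H) (ξ : Plane) :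
    cv F H ξ ^ 2 ≤ (∫⁻ η, F η ^ 2) * ∫⁻ η, H η ^ 2 := by
  refine (sq_lintegral_mul_le (by fun_prop) (by fun_prop)).trans_eq ?_
  rw [lintegral_sub_left_eq_self (fun η => F η ^ 2) ξ]

/-- Young's inequality `L¹ * L² ⊆ L²`. -/
lemma lintegral_sq_cv_le {F H : Plane → ℝ≥0∞} (hF : Measurable F) (hH : Measurable H) :
    ∫⁻ ξ, cv F H ξ ^ 2 ≤ (∫⁻ ξ, F ξ) ^ 2 * ∫⁻ ξ, H ξ ^ 2 := by
  have key : ∀ ξ, cv F H ξ ^ 2 ≤ (∫⁻ ξ, F ξ) * cv F (fun η => H η ^ 2) ξ := by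
    intro ξ
    have h : ∀ η, F (ξ - η) * H η =
        F (ξ - η) ^ (1 / 2 : ℝ) * (F (ξ - η) ^ (1 / 2 : ℝ) * H η) := by
      intro η
      rw [← mul_assoc, ← ENNReal.rpow_add_of_nonneg _ _ (by norm_num) (by norm_num)]
      norm_num
    have h2 : ∀ x : ℝ≥0∞, (x ^ (1 / (2:ℝ))) ^ 2 = x := fun x => by
      rw [← ENNReal.rpow_mul_natCast]; norm_num
    unfold cv
    simp_rw [h]
    refine (sq_lintegral_mul_le (by fun_prop) (by fun_prop)).trans_eq ?_
    simp_rw [mul_pow, h2]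
    rw [lintegral_sub_left_eq_self F ξ]
  calc _ ≤ ∫⁻ ξ, (∫⁻ ξ, F ξ) * cv F (fun η => H η ^ 2) ξ := lintegral_mono key
    _ = _ := by
      rw [lintegral_const_mul _ (measurable_cv hF (by fun_prop)), lintegral_cv hF (by fun_prop)]
      ring

/-- The low frequencies of the second factor in the product estimate. -/
lemma exists_lintegral_low_le {a b : ℝ} (hb : b < 1) :
    ∃ C : ℝ≥0, ∀ F H : Plane → ℝ≥0∞, Measurable F → Measurable H →
      ∫⁻ ξ, wt (2 * (a + b - 1)) ξ *
        (∫⁻ η in Metric.closedBall (0 : Plane) (‖ξ‖ / 2), F (ξ - η) * H η) ^ 2 ≤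
      C * ((∫⁻ ξ, wt (2 * a) ξ * F ξ ^ 2) * ∫⁻ ξ, wt (2 * b) ξ * H ξ ^ 2) := by
  obtain ⟨C₀, hC₀⟩ := exists_lintegral_wt_ball_le (p := -(2 * b)) (by linarith)
  refine ⟨C₀ * Real.toNNReal ((1/2) ^ (-(2 * b) + 2)) * Real.toNNReal (2 ^ |2 * a|),
    fun F H hF hH => ?_⟩
  have key : ∀ ξ : Plane, ξ ≠ 0 → wt (2 * (a + b - 1)) ξ *
        (∫⁻ η in Metric.closedBall (0 : Plane) (‖ξ‖ / 2), F (ξ - η) * H η) ^ 2 ≤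
      (C₀ * Real.toNNReal ((1/2) ^ (-(2 * b) + 2)) * Real.toNNReal (2 ^ |2 * a|) : ℝ≥0) *
        cv (fun η => wt (2 * a) η * F η ^ 2) (fun η => wt (2 * b) η * H η ^ 2) ξ := by
    intro ξ hξ
    set B := Metric.closedBall (0 : Plane) (‖ξ‖ / 2)
    have hB : MeasurableSet B := measurableSet_closedBall
    have e1 : (∫⁻ η in B, F (ξ - η) * H η) ^ 2 ≤
        (∫⁻ η in B, wt (-(2 * b)) η) * ∫⁻ η in B, wt (2 * b) η * (F (ξ - η) * H η) ^ 2 := by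
      have := sq_setLIntegral_mul_le_wt b (S := B) (u := fun _ => 1)
        (v := fun η => F (ξ - η) * H η) (by fun_prop) (by fun_prop)
      simpa using this
    have e2 : ∫⁻ η in B, wt (-(2 * b)) η ≤
        C₀ * (Real.toNNReal ((1/2) ^ (-(2 * b) + 2)) * wt (-(2 * b) + 2) ξ) := by
      refine (hC₀ _ (by positivity)).trans_eq ?_
      rw [wt, ← ENNReal.ofReal, ← ENNReal.ofReal_mul (by positivity),
        ← Real.mul_rpow (by positivity) (norm_nonneg _)]
      ring_nf
    have e3 : wt (2 * a) ξ * ∫⁻ η in B, wt (2 * b) η * (F (ξ - η) * H η) ^ 2 ≤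
        Real.toNNReal (2 ^ |2 * a|) *
        cv (fun η => wt (2 * a) η * F η ^ 2) (fun η => wt (2 * b) η * H η ^ 2) ξ := by
      unfold cv
      rw [← lintegral_const_mul _ (by fun_prop), ← lintegral_const_mul _ (by fun_prop)]
      refine (setLIntegral_mono' hB fun η hη => ?_).trans (setLIntegral_le_lintegral _ _)
      have hη' : ‖η‖ ≤ ‖ξ‖ / 2 := by simpa [B] using hη
      have h1 : ‖ξ‖ ≤ 2 * ‖ξ - η‖ := by
        have := norm_sub_norm_le ξ η; linarith
      have h2 : ‖ξ - η‖ ≤ 2 * ‖ξ‖ := by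
        have := norm_sub_le ξ η; have := norm_nonneg ξ; linarith
      have := wt_le_of_comparable (by norm_num) (2 * a) h1 h2
      calc _ ≤ (ENNReal.ofReal (2 ^ |2 * a|) * wt (2 * a) (ξ - η)) *
            (wt (2 * b) η * (F (ξ - η) * H η) ^ 2) := by gcongr
        _ = _ := by rw [ENNReal.ofReal]; ring
    calc _ ≤ wt (2 * (a + b - 1)) ξ * ((C₀ * (Real.toNNReal ((1/2) ^ (-(2 * b) + 2)) *
            wt (-(2 * b) + 2) ξ)) * ∫⁻ η in B, wt (2 * b) η * (F (ξ - η) * H η) ^ 2) := by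
          gcongr; exact e1.trans (by gcongr)
      _ = C₀ * Real.toNNReal ((1/2) ^ (-(2 * b) + 2)) *
          ((wt (2 * (a + b - 1)) ξ * wt (-(2 * b) + 2) ξ) *
            ∫⁻ η in B, wt (2 * b) η * (F (ξ - η) * H η) ^ 2) := by ring
      _ ≤ _ := by
        rw [← wt_add hξ, show 2 * (a + b - 1) + (-(2 * b) + 2) = 2 * a by ring]
        push_cast
        rw [mul_assoc (_ * _)]
        gcongr
  calc _ ≤ _ := lintegral_mono_ae (ae_ne_zero.mono key)
    _ = _ := by
      rw [lintegral_const_mul _ (measurable_cv (by fun_prop) (by fun_prop)),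
        lintegral_cv (by fun_prop) (by fun_prop)]

/-- The interaction of comparable high frequencies in the product estimate. -/
lemma exists_lintegral_high_le {a b : ℝ} (hab : 0 < a + b) :
    ∃ C : ℝ≥0, ∀ F H : Plane → ℝ≥0∞, Measurable F → Measurable H →
      ∫⁻ ξ, wt (2 * (a + b - 1)) ξ *
        (∫⁻ η in {η | ‖ξ‖ < 2 * ‖η‖ ∧ ‖ξ‖ < 2 * ‖ξ - η‖}, F (ξ - η) * H η) ^ 2 ≤
      C * ((∫⁻ ξ, wt (2 * a) ξ * F ξ ^ 2) * ∫⁻ ξ, wt (2 * b) ξ * H ξ ^ 2) := by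
  obtain ⟨C₀, hC₀⟩ := exists_lintegral_wt_ball_le (p := 2 * (a + b - 1)) (by linarith)
  refine ⟨Real.toNNReal (3 ^ |-(2 * b)|) * (C₀ * Real.toNNReal (2 ^ (2 * (a + b)))),
    fun F H hF hH => ?_⟩
  set NH := ∫⁻ ξ, wt (2 * b) ξ * H ξ ^ 2
  have key : ∀ ξ : Plane, wt (2 * (a + b - 1)) ξ *
        (∫⁻ η in {η | ‖ξ‖ < 2 * ‖η‖ ∧ ‖ξ‖ < 2 * ‖ξ - η‖}, F (ξ - η) * H η) ^ 2 ≤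
      Real.toNNReal (3 ^ |-(2 * b)|) * NH *
        ∫⁻ τ, (Metric.closedBall (0 : Plane) (2 * ‖τ‖)).indicator
        (wt (2 * (a + b - 1))) ξ * (wt (-(2 * b)) τ * F τ ^ 2) := by
    intro ξ
    set S := {η : Plane | ‖ξ‖ < 2 * ‖η‖ ∧ ‖ξ‖ < 2 * ‖ξ - η‖}
    have hS : MeasurableSet S :=
      MeasurableSet.inter (s₁ := {η : Plane | ‖ξ‖ < 2 * ‖η‖})
        (s₂ := {η : Plane | ‖ξ‖ < 2 * ‖ξ - η‖})
        (measurableSet_lt (by fun_prop) (by fun_prop))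
        (measurableSet_lt (by fun_prop) (by fun_prop))
    have e1 : (∫⁻ η in S, F (ξ - η) * H η) ^ 2 ≤
        (∫⁻ η in S, wt (-(2 * b)) η * F (ξ - η) ^ 2) * NH := by
      refine (sq_setLIntegral_mul_le_wt b (by fun_prop) hH).trans ?_
      gcongr
      exact setLIntegral_le_lintegral _ _
    have e2 : wt (2 * (a + b - 1)) ξ * ∫⁻ η in S, wt (-(2 * b)) η * F (ξ - η) ^ 2 ≤
        Real.toNNReal (3 ^ |-(2 * b)|) *
        ∫⁻ τ, (Metric.closedBall (0 : Plane) (2 * ‖τ‖)).indicator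
        (wt (2 * (a + b - 1))) ξ * (wt (-(2 * b)) τ * F τ ^ 2) := by
      rw [← lintegral_sub_left_eq_self (fun τ =>
        (Metric.closedBall (0 : Plane) (2 * ‖τ‖)).indicator
        (wt (2 * (a + b - 1))) ξ * (wt (-(2 * b)) τ * F τ ^ 2)) ξ,
        ← lintegral_const_mul _ (by fun_prop), ← lintegral_const_mul' _ _ (by simp)]
      refine (setLIntegral_mono' hS fun η hη => ?_).trans (setLIntegral_le_lintegral _ _)
      have h0 : ξ ∈ Metric.closedBall (0 : Plane) (2 * ‖ξ - η‖) := by simpa using hη.2.le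
      rw [Set.indicator_of_mem h0]
      have h1 : ‖η‖ ≤ 3 * ‖ξ - η‖ := by
        have h3 := norm_sub_le ξ (ξ - η)
        rw [sub_sub_cancel] at h3
        linarith [hη.2]
      have h2 : ‖ξ - η‖ ≤ 3 * ‖η‖ := by
        have := norm_sub_le ξ η; linarith [hη.1]
      have := wt_le_of_comparable (by norm_num) (-(2 * b)) h1 h2
      calc _ ≤ wt (2 * (a + b - 1)) ξ * ((ENNReal.ofReal (3 ^ |-(2 * b)|) *
            wt (-(2 * b)) (ξ - η)) * F (ξ - η) ^ 2) := by gcongr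
        _ = _ := by rw [ENNReal.ofReal]; ring
    calc _ ≤ wt (2 * (a + b - 1)) ξ *
          ((∫⁻ η in S, wt (-(2 * b)) η * F (ξ - η) ^ 2) * NH) := by gcongr
      _ = (wt (2 * (a + b - 1)) ξ * ∫⁻ η in S, wt (-(2 * b)) η * F (ξ - η) ^ 2) * NH := by ring
      _ ≤ _ := by
        rw [mul_right_comm (ENNReal.ofNNReal _)]
        exact mul_le_mul_left e2 NH
  have hmeas : Measurable (fun p : Plane × Plane =>
      (Metric.closedBall (0 : Plane) (2 * ‖p.2‖)).indicator (wt (2 * (a + b - 1))) p.1 *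
        (wt (-(2 * b)) p.2 * F p.2 ^ 2)) := by
    have hs : MeasurableSet {p : Plane × Plane | ‖p.1‖ ≤ 2 * ‖p.2‖} :=
      measurableSet_le (by fun_prop) (by fun_prop)
    have : (fun p : Plane × Plane =>
        (Metric.closedBall (0 : Plane) (2 * ‖p.2‖)).indicator (wt (2 * (a + b - 1))) p.1) =
        {p : Plane × Plane | ‖p.1‖ ≤ 2 * ‖p.2‖}.indicator
          (fun p => wt (2 * (a + b - 1)) p.1) := by
      ext p
      by_cases h : ‖p.1‖ ≤ 2 * ‖p.2‖ <;> simp [Set.indicator, h]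
    exact (this ▸ (Measurable.indicator (by fun_prop) hs)).mul (by fun_prop)
  calc _ ≤ ∫⁻ ξ, Real.toNNReal (3 ^ |-(2 * b)|) * NH *
        ∫⁻ τ, (Metric.closedBall (0 : Plane) (2 * ‖τ‖)).indicator
        (wt (2 * (a + b - 1))) ξ * (wt (-(2 * b)) τ * F τ ^ 2) := lintegral_mono key
    _ = Real.toNNReal (3 ^ |-(2 * b)|) * NH * ∫⁻ τ, (∫⁻ ξ in Metric.closedBall 0 (2 * ‖τ‖),
        wt (2 * (a + b - 1)) ξ) * (wt (-(2 * b)) τ * F τ ^ 2) := by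
      rw [lintegral_const_mul _ (Measurable.lintegral_prod_right' hmeas),
        lintegral_lintegral_swap hmeas.aemeasurable]
      congr 1
      refine lintegral_congr fun τ => ?_
      simp only
      rw [lintegral_mul_const _ ((measurable_wt _).indicator measurableSet_closedBall),
        lintegral_indicator measurableSet_closedBall]
    _ ≤ Real.toNNReal (3 ^ |-(2 * b)|) * NH * ∫⁻ τ, (C₀ * Real.toNNReal (2 ^ (2 * (a + b)))) *
          (wt (2 * a) τ * F τ ^ 2) := by
      gcongr 1
      refine lintegral_mono_ae (ae_ne_zero.mono fun τ hτ => ?_)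
      have h1 := hC₀ (2 * ‖τ‖) (by positivity)
      rw [show 2 * (a + b - 1) + 2 = 2 * (a + b) by ring, Real.mul_rpow (by norm_num)
        (norm_nonneg _), ENNReal.ofReal_mul (by positivity)] at h1
      change _ ≤ C₀ * (_ * wt (2 * (a + b)) τ) at h1
      rw [show 2 * (a + b) = 2 * a + 2 * b by ring, wt_add hτ] at h1
      calc _ ≤ (C₀ * (ENNReal.ofReal (2 ^ (2 * a + 2 * b)) * (wt (2 * a) τ * wt (2 * b) τ))) *
            (wt (-(2 * b)) τ * F τ ^ 2) := by gcongr
        _ = C₀ * ENNReal.ofReal (2 ^ (2 * a + 2 * b)) * (wt (2 * a) τ *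
            (wt (-(2 * b)) τ * wt (2 * b) τ) * F τ ^ 2) := by ring
        _ = _ := by
          rw [wt_neg_mul hτ, mul_one, ENNReal.ofReal, show 2 * a + 2 * b = 2 * (a + b) by ring]
    _ = _ := by
      rw [lintegral_const_mul _ (by fun_prop)]
      push_cast
      ring

/-- The product estimate `Ḣ^a · Ḣ^b ⊆ Ḣ^{a+b-1}` in the plane, on the Fourier side. -/
theorem exists_lintegral_wt_sq_cv_le {a b : ℝ} (ha : a < 1) (hb : b < 1) (hab : 0 < a + b) :
    ∃ C : ℝ≥0, ∀ F H : Plane → ℝ≥0∞, Measurable F → Measurable H →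
      ∫⁻ ξ, wt (2 * (a + b - 1)) ξ * cv F H ξ ^ 2 ≤
      C * ((∫⁻ ξ, wt (2 * a) ξ * F ξ ^ 2) * ∫⁻ ξ, wt (2 * b) ξ * H ξ ^ 2) := by
  obtain ⟨C₁, h₁⟩ := exists_lintegral_low_le (a := a) hb
  obtain ⟨C₂, h₂⟩ := exists_lintegral_low_le (a := b) ha
  obtain ⟨C₃, h₃⟩ := exists_lintegral_high_le hab
  refine ⟨3 * (C₁ + C₂ + C₃), fun F H hF hH => ?_⟩
  set X := (∫⁻ ξ, wt (2 * a) ξ * F ξ ^ 2) * ∫⁻ ξ, wt (2 * b) ξ * H ξ ^ 2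
  have measI : ∀ F H : Plane → ℝ≥0∞, Measurable F → Measurable H → Measurable fun ξ : Plane =>
      ∫⁻ η in Metric.closedBall (0 : Plane) (‖ξ‖ / 2), F (ξ - η) * H η := by
    intro F H hF hH
    have hs : MeasurableSet {p : Plane × Plane | ‖p.2‖ ≤ ‖p.1‖ / 2} :=
      measurableSet_le (by fun_prop) (by fun_prop)
    have hm : Measurable ({p : Plane × Plane | ‖p.2‖ ≤ ‖p.1‖ / 2}.indicator
        (fun p => F (p.1 - p.2) * H p.2)) := Measurable.indicator (by fun_prop) hs
    have := Measurable.lintegral_prod_right' (ν := (volume : Measure Plane)) hm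
    convert this using 2 with ξ
    rw [← lintegral_indicator measurableSet_closedBall]
    refine lintegral_congr fun η => ?_
    by_cases h : ‖η‖ ≤ ‖ξ‖ / 2 <;> simp [Set.indicator, h]
  set I₁ := fun ξ : Plane => ∫⁻ η in Metric.closedBall (0 : Plane) (‖ξ‖ / 2), F (ξ - η) * H η
    with hI₁
  set I₂ := fun ξ : Plane => ∫⁻ η in Metric.closedBall (0 : Plane) (‖ξ‖ / 2), H (ξ - η) * F η
    with hI₂
  set I₃ := fun ξ : Plane =>
    ∫⁻ η in {η | ‖ξ‖ < 2 * ‖η‖ ∧ ‖ξ‖ < 2 * ‖ξ - η‖}, F (ξ - η) * H η with hI₃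
  have split : ∀ ξ, cv F H ξ ≤ I₁ ξ + I₂ ξ + I₃ ξ := by
    intro ξ
    have e2 : I₂ ξ = ∫⁻ η in {η | ‖ξ - η‖ ≤ ‖ξ‖ / 2}, F (ξ - η) * H η := by
      have hs : MeasurableSet {η : Plane | ‖ξ - η‖ ≤ ‖ξ‖ / 2} :=
        measurableSet_le (by fun_prop) measurable_const
      rw [hI₂, ← lintegral_indicator hs]
      simp only
      rw [← lintegral_indicator measurableSet_closedBall, ← lintegral_sub_left_eq_self _ ξ]
      refine lintegral_congr fun η => ?_
      by_cases h : ‖ξ - η‖ ≤ ‖ξ‖ / 2 <;> simp [Set.indicator, h, mul_comm]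
    rw [e2]
    unfold cv
    rw [← setLIntegral_univ]
    have hsub : (Set.univ : Set Plane) ⊆ (Metric.closedBall (0 : Plane) (‖ξ‖ / 2) ∪
        {η | ‖ξ - η‖ ≤ ‖ξ‖ / 2}) ∪ {η | ‖ξ‖ < 2 * ‖η‖ ∧ ‖ξ‖ < 2 * ‖ξ - η‖} := by
      intro η _
      by_cases h1 : ‖η‖ ≤ ‖ξ‖ / 2
      · left; left; simpa using h1
      by_cases h2 : ‖ξ - η‖ ≤ ‖ξ‖ / 2
      · left; right; exact h2
      · right; constructor <;> linarith
    refine (lintegral_mono_set hsub).trans ?_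
    refine (lintegral_union_le _ _ _).trans ?_
    gcongr
    exact lintegral_union_le _ _ _
  have hsq : ∀ x y z : ℝ≥0∞, (x + y + z) ^ 2 ≤ 3 * (x ^ 2 + y ^ 2 + z ^ 2) := by
    intro x y z
    induction x using ENNReal.recTopCoe with
    | top => simp
    | coe x =>
    induction y using ENNReal.recTopCoe with
    | top => simp
    | coe y =>
    induction z using ENNReal.recTopCoe with
    | top => simp
    | coe z =>
    norm_cast
    rw [← NNReal.coe_le_coe]
    push_cast
    nlinarith [sq_nonneg ((x : ℝ) - y), sq_nonneg ((x : ℝ) - z), sq_nonneg ((y : ℝ) - z)]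
  have m1 : Measurable I₁ := measI F H hF hH
  have m2 : Measurable I₂ := measI H F hH hF
  calc _ ≤ ∫⁻ ξ, 3 * ((wt (2 * (a + b - 1)) ξ * I₁ ξ ^ 2 + wt (2 * (a + b - 1)) ξ * I₂ ξ ^ 2) +
        wt (2 * (a + b - 1)) ξ * I₃ ξ ^ 2) := by
        refine lintegral_mono fun ξ => ?_
        calc _ ≤ wt (2 * (a + b - 1)) ξ * (3 * (I₁ ξ ^ 2 + I₂ ξ ^ 2 + I₃ ξ ^ 2)) := by
              gcongr
              exact (pow_le_pow_left' (split ξ) 2).trans (hsq _ _ _)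
          _ = _ := by ring
    _ = 3 * ((∫⁻ ξ, wt (2 * (a + b - 1)) ξ * I₁ ξ ^ 2) +
        (∫⁻ ξ, wt (2 * (a + b - 1)) ξ * I₂ ξ ^ 2) +
        ∫⁻ ξ, wt (2 * (a + b - 1)) ξ * I₃ ξ ^ 2) := by
      rw [lintegral_const_mul' _ _ (by simp), lintegral_add_left (by fun_prop),
        lintegral_add_left (by fun_prop)]
    _ ≤ 3 * (C₁ * X + C₂ * X + C₃ * X) := by
      gcongr
      · exact h₁ F H hF hH
      · have := h₂ H F hH hF
        rw [add_comm b a] at this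
        rwa [mul_comm (∫⁻ ξ, wt (2 * b) ξ * H ξ ^ 2)] at this
      · exact h₃ F H hF hH
    _ = _ := by push_cast; ring

/-- The product estimate `(W ∩ Ḣ¹) · Ḣ^s ⊆ Ḣ^s` for `0 ≤ s < 1`, on the Fourier side. -/
theorem exists_lintegral_wt_sq_cv_le_of_l1 {s : ℝ} (hs0 : 0 ≤ s) (hs1 : s < 1) :
    ∃ C : ℝ≥0, ∀ F H : Plane → ℝ≥0∞, Measurable F → Measurable H →
      ∫⁻ ξ, wt (2 * s) ξ * cv F H ξ ^ 2 ≤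
      C * (((∫⁻ ξ, F ξ) ^ 2 + ∫⁻ ξ, wt 2 ξ * F ξ ^ 2) * ∫⁻ ξ, wt (2 * s) ξ * H ξ ^ 2) := by
  rcases hs0.eq_or_lt with rfl | hs0
  · refine ⟨1, fun F H hF hH => ?_⟩
    simp only [mul_zero, wt_zero, one_mul, ENNReal.coe_one]
    refine (lintegral_sq_cv_le hF hH).trans ?_
    gcongr
    exact le_self_add
  obtain ⟨C, hC⟩ := exists_lintegral_wt_sq_cv_le (a := 1 - s) (b := s) (by linarith) hs1
    (by linarith)
  refine ⟨8 * (C + 1), fun F H hF hH => ?_⟩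
  have hpt : ∀ ξ η : Plane, wt s ξ ≤ 2 * (wt s (ξ - η) + wt s η) := by
    intro ξ η
    unfold wt
    rw [← ENNReal.ofReal_add (by positivity) (by positivity),
      two_mul (ENNReal.ofReal _), ← ENNReal.ofReal_add (by positivity) (by positivity)]
    refine ENNReal.ofReal_le_ofReal ?_
    have h1 : ‖ξ‖ ≤ ‖ξ - η‖ + ‖η‖ := by simpa using norm_add_le (ξ - η) η
    have h2 := Real.rpow_le_rpow (norm_nonneg _) h1 hs0.le
    have h3 := Real.rpow_add_le_add_rpow (norm_nonneg (ξ - η)) (norm_nonneg η) hs0.le hs1.le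
    have : 0 ≤ ‖ξ - η‖ ^ s + ‖η‖ ^ s := by positivity
    linarith
  have hcv : ∀ ξ, wt s ξ * cv F H ξ ≤
      2 * (cv (fun η => wt s η * F η) H ξ + cv F (fun η => wt s η * H η) ξ) := by
    intro ξ
    unfold cv
    rw [← lintegral_add_left (by fun_prop), ← lintegral_const_mul _ (by fun_prop),
      ← lintegral_const_mul _ (by fun_prop)]
    refine lintegral_mono fun η => ?_
    calc _ ≤ (2 * (wt s (ξ - η) + wt s η)) * (F (ξ - η) * H η) := by gcongr; exact hpt ξ η
      _ = _ := by ring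
  have hsq : ∀ x y : ℝ≥0∞, (2 * (x + y)) ^ 2 ≤ 8 * (x ^ 2 + y ^ 2) := by
    intro x y
    calc _ = 4 * (x + y) ^ 2 := by ring
      _ ≤ 4 * (2 * (x ^ 2 + y ^ 2)) := by gcongr; exact sq_add_le x y
      _ = _ := by ring
  have h1 := hC (fun η => wt s η * F η) H (by fun_prop) hH
  have h2 := lintegral_sq_cv_le (H := fun η => wt s η * H η) hF (by fun_prop)
  have e1 : ∫⁻ ξ, wt (2 * (1 - s)) ξ * (wt s ξ * F ξ) ^ 2 = ∫⁻ ξ, wt 2 ξ * F ξ ^ 2 := by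
    refine lintegral_congr_ae (ae_ne_zero.mono fun ξ hξ => ?_)
    simp only
    rw [mul_pow, wt_sq, ← mul_assoc, ← wt_add hξ]
    ring_nf
  rw [e1] at h1
  simp only [sub_add_cancel, sub_self, mul_zero, wt_zero, one_mul] at h1
  simp_rw [mul_pow, wt_sq] at h2
  calc _ ≤ ∫⁻ ξ, 8 * (cv (fun η => wt s η * F η) H ξ ^ 2 +
        cv F (fun η => wt s η * H η) ξ ^ 2) := by
        refine lintegral_mono fun ξ => ?_
        rw [← wt_sq, ← mul_pow]
        exact (pow_le_pow_left' (hcv ξ) 2).trans (hsq _ _)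
    _ = 8 * ((∫⁻ ξ, cv (fun η => wt s η * F η) H ξ ^ 2) +
        ∫⁻ ξ, cv F (fun η => wt s η * H η) ξ ^ 2) := by
      have := measurable_cv (F := fun η => wt s η * F η) (by fun_prop) hH
      rw [lintegral_const_mul' _ _ (by simp), lintegral_add_left (by fun_prop)]
    _ ≤ 8 * (C * ((∫⁻ ξ, wt 2 ξ * F ξ ^ 2) * ∫⁻ ξ, wt (2 * s) ξ * H ξ ^ 2) +
        (∫⁻ ξ, F ξ) ^ 2 * ∫⁻ ξ, wt (2 * s) ξ * H ξ ^ 2) := by gcongr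
    _ ≤ 8 * (C * (((∫⁻ ξ, F ξ) ^ 2 + ∫⁻ ξ, wt 2 ξ * F ξ ^ 2) *
          ∫⁻ ξ, wt (2 * s) ξ * H ξ ^ 2) +
        ((∫⁻ ξ, F ξ) ^ 2 + ∫⁻ ξ, wt 2 ξ * F ξ ^ 2) * ∫⁻ ξ, wt (2 * s) ξ * H ξ ^ 2) := by
      gcongr
      · exact le_add_self
      · exact le_self_add
    _ = _ := by push_cast; ring

section Represents

variable {u v : Plane → ℂ} {S T : 𝓢'(Plane, ℂ)}

lemma Represents.congr (h : Represents u T) (huv : u =ᵐ[volume] v) : Represents v T := by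
  intro θ
  have e : (fun x => u x * θ x) =ᵐ[volume] fun x => v x * θ x := by
    filter_upwards [huv] with x hx
    rw [hx]
  exact ⟨(h θ).1.congr e, (h θ).2.trans (integral_congr_ae e)⟩

lemma Represents.sub (hu : Represents u S) (hv : Represents v T) :
    Represents (fun x => u x - v x) (S - T) := by
  intro θ
  have e : (fun x => (u x - v x) * θ x) = (fun x => u x * θ x) - fun x => v x * θ x := by
    ext x; simp [sub_mul]
  rw [e]
  refine ⟨(hu θ).1.sub (hv θ).1, ?_⟩
  rw [Pi.sub_def, integral_sub (hu θ).1 (hv θ).1, ← (hu θ).2, ← (hv θ).2]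
  rfl

lemma Represents.add (hu : Represents u S) (hv : Represents v T) :
    Represents (fun x => u x + v x) (S + T) := by
  intro θ
  have e : (fun x => (u x + v x) * θ x) = (fun x => u x * θ x) + fun x => v x * θ x := by
    ext x; simp [add_mul]
  rw [e]
  refine ⟨(hu θ).1.add (hv θ).1, ?_⟩
  rw [Pi.add_def, integral_add (hu θ).1 (hv θ).1, ← (hu θ).2, ← (hv θ).2]
  rfl

lemma exists_schwartz_eq_one (R : ℝ) : ∃ θ : 𝓢(Plane, ℂ), ∀ x, ‖x‖ ≤ R → θ x = 1 := by
  let b : ContDiffBump (0 : Plane) := ⟨|R| + 1, |R| + 2, by positivity, by linarith⟩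
  have h1 : HasCompactSupport (Complex.ofRealCLM ∘ b) := b.hasCompactSupport.comp_left rfl
  have h2 : ContDiff ℝ (⊤ : ℕ∞) (Complex.ofRealCLM ∘ b) :=
    Complex.ofRealCLM.contDiff.comp b.contDiff
  refine ⟨h1.toSchwartzMap h2, fun x hx => ?_⟩
  have : b x = 1 := b.one_of_mem_closedBall (by
    simp only [Metric.mem_closedBall, dist_zero_right, b]
    linarith [le_abs_self R])
  simp [this]

lemma Represents.locallyIntegrable (h : Represents u T) : LocallyIntegrable u := by
  rw [locallyIntegrable_iff]
  intro K hK
  obtain ⟨R, hR⟩ := hK.isBounded.exists_norm_le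
  obtain ⟨θ, hθ⟩ := exists_schwartz_eq_one R
  refine ((h θ).1.integrableOn (s := K)).congr_fun (fun x hx => ?_) hK.measurableSet
  simp [hθ x (hR x hx)]

lemma Represents.aestronglyMeasurable (h : Represents u T) : AEStronglyMeasurable u :=
  h.locallyIntegrable.aestronglyMeasurable

lemma Represents.exists_measurable (h : Represents u T) :
    ∃ v : Plane → ℂ, Measurable v ∧ u =ᵐ[volume] v ∧ Represents v T :=
  ⟨h.aestronglyMeasurable.mk u, h.aestronglyMeasurable.stronglyMeasurable_mk.measurable,
    h.aestronglyMeasurable.ae_eq_mk, h.congr h.aestronglyMeasurable.ae_eq_mk⟩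

lemma Represents.ae_eq (hu : Represents u T) (hv : Represents v T) : u =ᵐ[volume] v := by
  refine ae_eq_of_integral_contDiff_smul_eq hu.locallyIntegrable hv.locallyIntegrable
    fun g hg hgc => ?_
  have h1 : HasCompactSupport (Complex.ofRealCLM ∘ g) := hgc.comp_left rfl
  have h2 : ContDiff ℝ (⊤ : ℕ∞) (Complex.ofRealCLM ∘ g) := Complex.ofRealCLM.contDiff.comp hg
  have := (hu (h1.toSchwartzMap h2)).2.symm.trans (hv (h1.toSchwartzMap h2)).2
  simpa [mul_comm] using this

lemma represents_toTemperedDistribution {p : ℝ≥0∞} [Fact (1 ≤ p)] (U : Lp (α := Plane) ℂ p) :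
    Represents U (U : 𝓢'(Plane, ℂ)) := by
  intro θ
  have := ENNReal.HolderConjugate.inv_one_sub_inv' (Fact.out : 1 ≤ p)
  refine ⟨(Lp.memLp U).integrable_mul (θ.memLp (1 - p⁻¹)⁻¹), ?_⟩
  rw [Lp.toTemperedDistribution_apply]
  simp [mul_comm]

lemma exists_represents {p : ℝ≥0∞} [Fact (1 ≤ p)] (hu : MemLp u p) :
    ∃ T : 𝓢'(Plane, ℂ), Represents u T :=
  ⟨hu.toLp u, (represents_toTemperedDistribution (hu.toLp u)).congr hu.coeFn_toLp⟩

end Represents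

lemma fourierNorm_eq {w : Plane → ℂ} {T : 𝓢'(Plane, ℂ)} (h : Represents w (𝓕 T)) (p : ℝ≥0∞)
    (σ : ℝ) : fourierNorm p σ T = eLpNorm (fun ξ => ((‖ξ‖ ^ σ : ℝ) : ℂ) * w ξ) p volume := by
  refine le_antisymm (iInf₂_le w h) (le_iInf₂ fun w' hw' => le_of_eq ?_)
  refine eLpNorm_congr_ae ?_
  filter_upwards [h.ae_eq hw'] with ξ hξ
  rw [hξ]

lemma eLpNorm_two_sq (u : Plane → ℂ) : eLpNorm u 2 ^ 2 = ∫⁻ x, ‖u x‖ₑ ^ 2 := by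
  have := eLpNorm_nnreal_pow_eq_lintegral (f := u) (μ := volume) (p := 2) (by norm_num)
  simpa using this

lemma memLp_two_iff {u : Plane → ℂ} (hu : AEStronglyMeasurable u) :
    MemLp u 2 ↔ ∫⁻ x, ‖u x‖ₑ ^ 2 < ∞ := by
  rw [← eLpNorm_two_sq]
  constructor
  · intro h
    exact ENNReal.pow_lt_top h.2
  · intro h
    refine ⟨hu, ?_⟩
    by_contra hc
    rw [not_lt_top_iff] at hc
    simp [hc] at h

lemma enorm_weight_mul (σ : ℝ) (w : Plane → ℂ) (ξ : Plane) :
    ‖((‖ξ‖ ^ σ : ℝ) : ℂ) * w ξ‖ₑ = wt σ ξ * ‖w ξ‖ₑ := by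
  rw [enorm_mul, ← ofReal_norm, Complex.norm_real, Real.norm_of_nonneg (by positivity), wt]

lemma hdotNorm_sq {w : Plane → ℂ} {T : 𝓢'(Plane, ℂ)} (h : Represents w (𝓕 T)) (σ : ℝ) :
    hdotNorm σ T ^ 2 = ∫⁻ ξ, wt (2 * σ) ξ * ‖w ξ‖ₑ ^ 2 := by
  rw [hdotNorm, fourierNorm_eq h, eLpNorm_two_sq]
  simp_rw [enorm_weight_mul, mul_pow, wt_sq]

lemma fourierNorm_one {w : Plane → ℂ} {T : 𝓢'(Plane, ℂ)} (h : Represents w (𝓕 T)) (σ : ℝ) :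
    fourierNorm 1 σ T = ∫⁻ ξ, wt σ ξ * ‖w ξ‖ₑ := by
  rw [fourierNorm_eq h, eLpNorm_one_eq_lintegral_enorm]
  simp_rw [enorm_weight_mul]

section FourierDual

/-- The space `L²(ℝ²)`. -/
abbrev PlaneL2 : Type := Lp (α := Plane) ℂ 2 volume

lemma continuous_fourierInv_of_integrable {w : Plane → ℂ} (hw : Integrable w) : Continuous (𝓕⁻ w) :=
  VectorFourier.fourierIntegral_continuous (L := -innerₗ Plane) Real.continuous_fourierChar
    (by simp only [LinearMap.neg_apply, innerₗ_apply_apply]; fun_prop) hw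

lemma norm_fourierInv_le {w : Plane → ℂ} (ξ : Plane) : ‖𝓕⁻ w ξ‖ ≤ ∫ x, ‖w x‖ :=
  VectorFourier.norm_fourierIntegral_le_integral_norm _ _ (-innerₗ Plane) w ξ

lemma integral_fourierInv_mul_eq {w q : Plane → ℂ} (hw : Integrable w) (hq : Integrable q) :
    ∫ x, 𝓕⁻ w x * q x = ∫ x, w x * 𝓕⁻ q x := by
  have h := VectorFourier.integral_fourierIntegral_smul_eq_flip (L := -innerₗ Plane)
    Real.continuous_fourierChar
    (by simp only [LinearMap.neg_apply, innerₗ_apply_apply]; fun_prop) hw hq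
  have hf : (-innerₗ Plane).flip = -innerₗ Plane := by
    ext x y
    simp [real_inner_comm]
  rw [hf] at h
  exact h

lemma integrable_fourierInv_mul {w q : Plane → ℂ} (hw : Integrable w) (hq : Integrable q) :
    Integrable fun x => 𝓕⁻ w x * q x :=
  hq.bdd_mul (continuous_fourierInv_of_integrable hw).aestronglyMeasurable
    (Filter.Eventually.of_forall norm_fourierInv_le)

lemma represents_fourierInv {w : Plane → ℂ} (hw : Integrable w) {T : 𝓢'(Plane, ℂ)}
    (hT : Represents w T) : Represents (𝓕⁻ w) (𝓕⁻ T) := by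
  intro θ
  refine ⟨integrable_fourierInv_mul hw θ.integrable, ?_⟩
  rw [integral_fourierInv_mul_eq hw θ.integrable, TemperedDistribution.fourierInv_apply,
    (hT _).2, SchwartzMap.fourierInv_coe]

/-- The inverse Fourier transform on `L¹ ∩ L²` is given by the integral. -/
lemma fourierInv_toLp_ae_eq {q : Plane → ℂ} (hq1 : Integrable q) (hq2 : MemLp q 2) :
    ((𝓕⁻ (hq2.toLp q) : PlaneL2) : Plane → ℂ) =ᵐ[volume] 𝓕⁻ q := by
  have h1 : Represents q (hq2.toLp q : 𝓢'(Plane, ℂ)) :=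
    (represents_toTemperedDistribution _).congr hq2.coeFn_toLp
  refine Represents.ae_eq ?_ (represents_fourierInv hq1 h1)
  rw [Lp.fourierInv_toTemperedDistribution_eq]
  exact represents_toTemperedDistribution _

lemma integral_fourierInv_mul_eq_lp (W Q : PlaneL2) :
    ∫ x, (𝓕⁻ W : PlaneL2) x * Q x = ∫ x, W x * (𝓕⁻ Q : PlaneL2) x := by
  let B := (ContinuousLinearMap.mul ℂ ℂ).lpPairing (volume : Measure Plane) 2 2
  have hB : ∀ U V : PlaneL2, B U V = ∫ x, U x * V x := fun U V => by
    rw [ContinuousLinearMap.lpPairing_eq_integral]; rfl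
  rw [← hB, ← hB]
  refine DenseRange.induction_on (p := fun Q : PlaneL2 => B (𝓕⁻ W) Q = B W (𝓕⁻ Q))
    (SchwartzMap.denseRange_toLpCLM (p := 2) (μ := (volume : Measure Plane))
      ENNReal.ofNat_ne_top) Q ?_ fun θ => ?_
  · exact isClosed_eq (B (𝓕⁻ W)).continuous
      ((B W).continuous.comp FourierTransform.continuous_fourierInv)
  · have h := congrArg (fun T : 𝓢'(Plane, ℂ) => T θ) (Lp.fourierInv_toTemperedDistribution_eq W)
    simp only [TemperedDistribution.fourierInv_apply] at h
    rw [(represents_toTemperedDistribution W _).2,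
      (represents_toTemperedDistribution (𝓕⁻ W : PlaneL2) _).2] at h
    rw [SchwartzMap.toLpCLM_apply, SchwartzMap.toLp_fourierInv_eq, hB, hB]
    have e1 : ∫ x, (𝓕⁻ W : PlaneL2) x * (θ.toLp 2 volume : PlaneL2) x =
        ∫ x, (𝓕⁻ W : PlaneL2) x * θ x := by
      refine integral_congr_ae ?_
      filter_upwards [θ.coeFn_toLp 2 volume] with x hx
      rw [hx]
    have e2 : ∫ x, W x * ((𝓕⁻ θ : 𝓢(Plane, ℂ)).toLp 2 volume : PlaneL2) x =
        ∫ x, W x * (𝓕⁻ θ : 𝓢(Plane, ℂ)) x := by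
      refine integral_congr_ae ?_
      filter_upwards [(𝓕⁻ θ : 𝓢(Plane, ℂ)).coeFn_toLp 2 volume] with x hx
      rw [hx]
    rw [e1, e2, h]

/-- `v` is the inverse Fourier transform of `w`, in the sense of duality with `L¹ ∩ L²`. -/
def FourierDual (v w : Plane → ℂ) : Prop :=
  ∀ q : Plane → ℂ, Integrable q → MemLp q 2 →
    Integrable (fun x => v x * q x) ∧ Integrable (fun x => w x * 𝓕⁻ q x) ∧
      ∫ x, v x * q x = ∫ x, w x * 𝓕⁻ q x

variable {v w v' w' : Plane → ℂ}

lemma FourierDual.add (h : FourierDual v w) (h' : FourierDual v' w') :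
    FourierDual (fun x => v x + v' x) (fun x => w x + w' x) := by
  intro q hq1 hq2
  obtain ⟨a, b, c⟩ := h q hq1 hq2
  obtain ⟨a', b', c'⟩ := h' q hq1 hq2
  simp_rw [add_mul]
  refine ⟨a.add a', b.add b', ?_⟩
  rw [integral_add a a', integral_add b b', c, c']

lemma fourierDual_of_integrable (hw : Integrable w) : FourierDual (𝓕⁻ w) w := by
  intro q hq1 _
  refine ⟨integrable_fourierInv_mul hw hq1, ?_, integral_fourierInv_mul_eq hw hq1⟩
  simpa [mul_comm] using integrable_fourierInv_mul hq1 hw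

/-- The inverse Fourier transform of a square integrable function. -/
noncomputable def invL2 (w : Plane → ℂ) (hw : MemLp w 2) : Plane → ℂ :=
  (𝓕⁻ (hw.toLp w) : PlaneL2)

lemma memLp_invL2 (hw : MemLp w 2) : MemLp (invL2 w hw) 2 := Lp.memLp _

lemma fourierDual_invL2 (hw : MemLp w 2) : FourierDual (invL2 w hw) w := by
  intro q hq1 hq2
  have h1 := fourierInv_toLp_ae_eq hq1 hq2
  have hm : MemLp (𝓕⁻ q) 2 := (memLp_congr_ae h1).1 (Lp.memLp _)
  refine ⟨(memLp_invL2 hw).integrable_mul hq2, hw.integrable_mul hm, ?_⟩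
  have h := integral_fourierInv_mul_eq_lp (hw.toLp w) (hq2.toLp q)
  have e1 : ∫ x, invL2 w hw x * q x = ∫ x, invL2 w hw x * hq2.toLp q x := by
    refine integral_congr_ae ?_
    filter_upwards [hq2.coeFn_toLp] with x hx
    rw [hx]
  rw [e1]
  refine h.trans (integral_congr_ae ?_)
  filter_upwards [h1, hw.coeFn_toLp] with x hx hx'
  rw [hx, hx']

lemma FourierDual.represents (h : FourierDual v w) {T : 𝓢'(Plane, ℂ)}
    (hw : Represents w (𝓕 T)) : Represents v T := by
  intro θ
  obtain ⟨a, -, c⟩ := h θ θ.integrable (θ.memLp 2 volume)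
  refine ⟨a, ?_⟩
  have h2 := (hw (𝓕⁻ θ)).2
  rw [TemperedDistribution.fourier_apply, fourier_fourierInv_eq] at h2
  rw [h2, c, SchwartzMap.fourierInv_coe]

/-- Plancherel's theorem. -/
lemma integral_invL2_mul_conj (hw : MemLp w 2) (hw' : MemLp w' 2) :
    ∫ x, invL2 w hw x * conj (invL2 w' hw' x) = ∫ x, w x * conj (w' x) := by
  have h := (Lp.fourierTransformₗᵢ Plane ℂ).symm.inner_map_map (hw'.toLp w') (hw.toLp w)
  rw [L2.inner_def, L2.inner_def] at h
  simp_rw [RCLike.inner_apply] at h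
  refine h.trans (integral_congr_ae ?_)
  filter_upwards [hw.coeFn_toLp, hw'.coeFn_toLp] with x hx hx'
  rw [hx, hx']

end FourierDual

/-- `W` is dominated by the sum of an integrable and a square integrable function. -/
def L1AddL2 (W : Plane → ℝ≥0∞) : Prop :=
  ∃ W₁ W₂ : Plane → ℝ≥0∞, Measurable W₁ ∧ Measurable W₂ ∧ (∀ ξ, W ξ ≤ W₁ ξ + W₂ ξ) ∧
    ∫⁻ ξ, W₁ ξ < ∞ ∧ ∫⁻ ξ, W₂ ξ ^ 2 < ∞

lemma cv_mono_right {F W W' : Plane → ℝ≥0∞} (h : ∀ ξ, W ξ ≤ W' ξ) (ξ : Plane) :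
    cv F W ξ ≤ cv F W' ξ := by
  unfold cv
  gcongr
  exact h _

lemma cv_add_right {F W₁ W₂ : Plane → ℝ≥0∞} (hF : Measurable F) (h₁ : Measurable W₁) (ξ : Plane) :
    cv F (fun η => W₁ η + W₂ η) ξ = cv F W₁ ξ + cv F W₂ ξ := by
  unfold cv
  simp_rw [mul_add]
  rw [lintegral_add_left (by fun_prop)]

lemma lintegral_mul_lt_top {u v : Plane → ℝ≥0∞} (hu : Measurable u) (hv : Measurable v)
    (hu2 : ∫⁻ ξ, u ξ ^ 2 < ∞) (hv2 : ∫⁻ ξ, v ξ ^ 2 < ∞) : ∫⁻ ξ, u ξ * v ξ < ∞ := by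
  have h := (sq_lintegral_mul_le hu.aemeasurable hv.aemeasurable).trans_lt
    (ENNReal.mul_lt_top hu2 hv2)
  exact (ENNReal.pow_lt_top_iff.1 h).resolve_right (by norm_num)

lemma lintegral_mul_cv_lt_top {F W ψ : Plane → ℝ≥0∞} (hF : Measurable F) (hW : L1AddL2 W)
    (hF2 : ∫⁻ ξ, F ξ ^ 2 < ∞) (hψ : Measurable ψ) (hψ1 : ∫⁻ ξ, ψ ξ < ∞)
    (hψ2 : ∫⁻ ξ, ψ ξ ^ 2 < ∞) : ∫⁻ ξ, ψ ξ * cv F W ξ < ∞ := by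
  obtain ⟨W₁, W₂, m₁, m₂, hle, h₁, h₂⟩ := hW
  have hb : ∀ ξ, cv F W₂ ξ ≤ 1 + (∫⁻ η, F η ^ 2) * ∫⁻ η, W₂ η ^ 2 := by
    intro ξ
    refine le_trans ?_ (add_le_add_right (sq_cv_le hF m₂ ξ) 1)
    rcases le_total (cv F W₂ ξ) 1 with h | h
    · exact h.trans le_self_add
    · exact (le_self_pow h two_ne_zero).trans le_add_self
  calc _ ≤ ∫⁻ ξ, (ψ ξ * cv F W₁ ξ + ψ ξ * (1 + (∫⁻ η, F η ^ 2) * ∫⁻ η, W₂ η ^ 2)) := by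
        refine lintegral_mono fun ξ => ?_
        rw [← mul_add]
        gcongr
        refine (cv_mono_right hle ξ).trans ?_
        rw [cv_add_right hF m₁]
        gcongr
        exact hb ξ
    _ = (∫⁻ ξ, ψ ξ * cv F W₁ ξ) +
        (∫⁻ ξ, ψ ξ) * (1 + (∫⁻ η, F η ^ 2) * ∫⁻ η, W₂ η ^ 2) := by
      rw [lintegral_add_left (by fun_prop), lintegral_mul_const _ hψ]
    _ < ∞ := by
      refine ENNReal.add_lt_top.2 ⟨lintegral_mul_lt_top hψ (by fun_prop) hψ2 ?_, ?_⟩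
      · rw [cv_comm]
        exact (lintegral_sq_cv_le m₁ hF).trans_lt (ENNReal.mul_lt_top (ENNReal.pow_lt_top h₁) hF2)
      · exact ENNReal.mul_lt_top hψ1 (ENNReal.add_lt_top.2
          ⟨ENNReal.one_lt_top, ENNReal.mul_lt_top hF2 h₂⟩)

lemma setLIntegral_sq_cv_lt_top {F W : Plane → ℝ≥0∞} (hF : Measurable F) (hW : L1AddL2 W)
    (hF2 : ∫⁻ ξ, F ξ ^ 2 < ∞) {S : Set Plane} (hS : volume S < ∞) :
    ∫⁻ ξ in S, cv F W ξ ^ 2 < ∞ := by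
  obtain ⟨W₁, W₂, m₁, m₂, hle, h₁, h₂⟩ := hW
  calc _ ≤ ∫⁻ ξ in S, 2 * (cv F W₁ ξ ^ 2 + (∫⁻ η, F η ^ 2) * ∫⁻ η, W₂ η ^ 2) := by
        refine lintegral_mono fun ξ => ?_
        refine (pow_le_pow_left' (cv_mono_right hle ξ) 2).trans ?_
        rw [cv_add_right hF m₁]
        refine (sq_add_le _ _).trans ?_
        gcongr
        exact sq_cv_le hF m₂ ξ
    _ = 2 * ((∫⁻ ξ in S, cv F W₁ ξ ^ 2) +
        ((∫⁻ η, F η ^ 2) * ∫⁻ η, W₂ η ^ 2) * volume S) := by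
      rw [lintegral_const_mul' _ _ (by simp), lintegral_add_left (by fun_prop),
        lintegral_const, Measure.restrict_apply_univ]
    _ < ∞ := by
      refine ENNReal.mul_lt_top (by simp) (ENNReal.add_lt_top.2 ⟨?_, ?_⟩)
      · refine (setLIntegral_le_lintegral _ _).trans_lt ?_
        rw [cv_comm]
        exact (lintegral_sq_cv_le m₁ hF).trans_lt (ENNReal.mul_lt_top (ENNReal.pow_lt_top h₁) hF2)
      · exact ENNReal.mul_lt_top (ENNReal.mul_lt_top hF2 h₂) hS

lemma lintegral_sq_cv_lt_top {F W : Plane → ℝ≥0∞} (hF : Measurable F) (hW : L1AddL2 W)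
    (hF2 : ∫⁻ ξ, F ξ ^ 2 < ∞) (hF1 : ∫⁻ ξ, F ξ < ∞) : ∫⁻ ξ, cv F W ξ ^ 2 < ∞ := by
  obtain ⟨W₁, W₂, m₁, m₂, hle, h₁, h₂⟩ := hW
  calc _ ≤ ∫⁻ ξ, 2 * (cv F W₁ ξ ^ 2 + cv F W₂ ξ ^ 2) := by
        refine lintegral_mono fun ξ => ?_
        refine (pow_le_pow_left' (cv_mono_right hle ξ) 2).trans ?_
        rw [cv_add_right hF m₁]
        exact sq_add_le _ _
    _ = 2 * ((∫⁻ ξ, cv F W₁ ξ ^ 2) + ∫⁻ ξ, cv F W₂ ξ ^ 2) := by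
      rw [lintegral_const_mul' _ _ (by simp), lintegral_add_left (by fun_prop)]
    _ < ∞ := by
      refine ENNReal.mul_lt_top (by simp) (ENNReal.add_lt_top.2 ⟨?_, ?_⟩)
      · rw [cv_comm]
        exact (lintegral_sq_cv_le m₁ hF).trans_lt (ENNReal.mul_lt_top (ENNReal.pow_lt_top h₁) hF2)
      · exact (lintegral_sq_cv_le hF m₂).trans_lt (ENNReal.mul_lt_top (ENNReal.pow_lt_top hF1) h₂)

/-- The convolution of two complex valued functions. -/
noncomputable def ccv (F w : Plane → ℂ) (ξ : Plane) : ℂ := ∫ η, F (ξ - η) * w η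

lemma measurable_ccv {F w : Plane → ℂ} (hF : Measurable F) (hw : Measurable w) :
    Measurable (ccv F w) := by
  have h : StronglyMeasurable (fun p : Plane × Plane => F (p.1 - p.2) * w p.2) := by
    apply Measurable.stronglyMeasurable
    fun_prop
  exact (StronglyMeasurable.integral_prod_right' (ν := volume) h).measurable

lemma enorm_ccv_le (F w : Plane → ℂ) (ξ : Plane) :
    ‖ccv F w ξ‖ₑ ≤ cv (fun η => ‖F η‖ₑ) (fun η => ‖w η‖ₑ) ξ := by
  refine (enorm_integral_le_lintegral_enorm _).trans_eq ?_
  simp_rw [enorm_mul]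
  rfl

/-- The modulation `x ↦ e^{2πi x·η} θ(x)`. -/
lemma modulation_props (θ : 𝓢(Plane, ℂ)) (η : Plane) :
    Integrable (fun x => (Real.fourierChar (inner ℝ x η) : ℂ) * θ x) ∧
      MemLp (fun x => (Real.fourierChar (inner ℝ x η) : ℂ) * θ x) 2 ∧
      ∀ ξ, 𝓕⁻ (fun x => (Real.fourierChar (inner ℝ x η) : ℂ) * θ x) ξ =
        𝓕⁻ (θ : Plane → ℂ) (ξ + η) := by
  have hc : Continuous fun x : Plane => (Real.fourierChar (inner ℝ x η) : ℂ) :=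
    continuous_subtype_val.comp (Real.continuous_fourierChar.comp (by fun_prop))
  have hn : ∀ x, ‖(Real.fourierChar (inner ℝ x η) : ℂ) * θ x‖ = ‖θ x‖ := fun x => by
    rw [norm_mul, Circle.norm_coe, one_mul]
  have hm : AEStronglyMeasurable (fun x => (Real.fourierChar (inner ℝ x η) : ℂ) * θ x) :=
    (hc.mul θ.continuous).aestronglyMeasurable
  refine ⟨?_, ?_, fun ξ => ?_⟩
  · exact θ.integrable.mono hm (Filter.Eventually.of_forall fun x => (hn x).le)
  · exact (θ.memLp 2 volume).mono hm (Filter.Eventually.of_forall fun x => (hn x).le)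
  · rw [Real.fourierInv_eq, Real.fourierInv_eq]
    congr 1 with x
    rw [inner_add_right, AddChar.map_add_eq_mul, Circle.smul_def, Circle.smul_def, smul_eq_mul,
      smul_eq_mul, Circle.coe_mul, mul_assoc]

lemma fourierInv_mul_schwartz {u F : Plane → ℂ} (huF : FourierDual u F) (θ : 𝓢(Plane, ℂ))
    (η : Plane) :
    𝓕⁻ (fun x => u x * θ x) η = ∫ ζ, F (ζ - η) * (𝓕⁻ θ : 𝓢(Plane, ℂ)) ζ := by
  obtain ⟨h1, h2, h3⟩ := modulation_props θ η
  have h := (huF _ h1 h2).2.2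
  simp_rw [h3] at h
  rw [Real.fourierInv_eq]
  calc _ = ∫ x, u x * ((Real.fourierChar (inner ℝ x η) : ℂ) * θ x) := by
        congr 1 with x
        rw [Circle.smul_def, smul_eq_mul]; ring
    _ = _ := h
    _ = _ := by
      rw [← integral_sub_right_eq_self _ η]
      simp [SchwartzMap.fourierInv_coe]

/-- The product of two functions has the convolution as its Fourier transform. -/
lemma integral_mul_mul_schwartz {v w u F : Plane → ℂ} (hvw : FourierDual v w)
    (huF : FourierDual u F) (hu : MemLp u 2) (hF : MemLp F 2) (mF : Measurable F)
    (mw : Measurable w) (hw : L1AddL2 fun ξ => ‖w ξ‖ₑ) (θ : 𝓢(Plane, ℂ)) :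
    Integrable (fun x => v x * u x * θ x) ∧
      Integrable (fun ξ => ccv F w ξ * (𝓕⁻ θ : 𝓢(Plane, ℂ)) ξ) ∧
      ∫ x, v x * u x * θ x = ∫ ξ, ccv F w ξ * (𝓕⁻ θ : 𝓢(Plane, ℂ)) ξ := by
  set ψ : 𝓢(Plane, ℂ) := 𝓕⁻ θ with hψ
  have q1 : Integrable fun x => u x * θ x := hu.integrable_mul (θ.memLp 2 volume)
  have q2 : MemLp (fun x => u x * θ x) 2 := (θ.memLp ∞ volume).mul hu
  obtain ⟨a, b, c⟩ := hvw _ q1 q2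
  simp_rw [fourierInv_mul_schwartz huF, ← hψ] at b c
  have mψ : Measurable ψ := ψ.continuous.measurable
  have hint : Integrable (Function.uncurry fun η ζ : Plane => w η * (F (ζ - η) * ψ ζ))
      (volume.prod volume) := by
    have hm : Measurable (Function.uncurry fun η ζ : Plane => w η * (F (ζ - η) * ψ ζ)) := by
      unfold Function.uncurry; fun_prop
    refine ⟨hm.aestronglyMeasurable, ?_⟩
    rw [HasFiniteIntegral, lintegral_prod_symm _ (by fun_prop)]
    have := lintegral_mul_cv_lt_top (F := fun η => ‖F η‖ₑ) (ψ := fun ξ => ‖ψ ξ‖ₑ) (by fun_prop) hw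
      ((memLp_two_iff hF.1).1 hF) (by fun_prop) ψ.integrable.2
      ((memLp_two_iff (ψ.memLp 2 volume).1).1 (ψ.memLp 2 volume))
    refine lt_of_eq_of_lt (lintegral_congr fun ζ => ?_) this
    unfold cv
    rw [← lintegral_const_mul _ (by fun_prop)]
    refine lintegral_congr fun η => ?_
    simp only [Function.uncurry, enorm_mul]
    ring
  have e1 : ∀ η, w η * ∫ ζ, F (ζ - η) * ψ ζ = ∫ ζ, w η * (F (ζ - η) * ψ ζ) := fun η =>
    (integral_const_mul _ _).symm
  have e2 : ∀ ζ, ∫ η, w η * (F (ζ - η) * ψ ζ) = ccv F w ζ * ψ ζ := fun ζ => by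
    rw [ccv, ← integral_mul_const]
    congr 1 with η
    ring
  refine ⟨?_, ?_, ?_⟩
  · simpa only [mul_assoc] using a
  · simpa only [Function.uncurry, e2] using hint.integral_prod_right
  · simp_rw [mul_assoc]
    rw [c]
    simp_rw [e1]
    rw [integral_integral_swap hint]
    simp_rw [e2]

lemma represents_fourier_mul {v w u F : Plane → ℂ} (hvw : FourierDual v w)
    (huF : FourierDual u F) (hu : MemLp u 2) (hF : MemLp F 2) (mF : Measurable F)
    (mw : Measurable w) (hw : L1AddL2 fun ξ => ‖w ξ‖ₑ) {T : 𝓢'(Plane, ℂ)}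
    (hT : Represents (fun x => v x * u x) T) : Represents (ccv F w) (𝓕 T) := by
  intro θ
  obtain ⟨-, b, c⟩ := integral_mul_mul_schwartz hvw huF hu hF mF mw hw (𝓕 θ)
  rw [fourierInv_fourier_eq] at b c
  refine ⟨b, ?_⟩
  rw [TemperedDistribution.fourier_apply, (hT _).2, c]

lemma contDiffAt_lamSymbol (σ : ℝ) {ξ : Plane} (hξ : ξ ≠ 0) : ContDiffAt ℝ 1 (lamSymbol σ) ξ := by
  have h : ContDiffAt ℝ 1 (fun ξ : Plane => ‖ξ‖ ^ σ) ξ :=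
    (contDiffAt_norm ℝ hξ).rpow_const_of_ne (norm_ne_zero_iff.2 hξ)
  exact Complex.ofRealCLM.contDiff.contDiffAt.comp ξ h

lemma lamSymbol_smul (σ : ℝ) {t : ℝ} (ht : 0 < t) (ξ : Plane) :
    lamSymbol σ (t • ξ) = ((t ^ σ : ℝ) : ℂ) * lamSymbol σ ξ := by
  rw [lamSymbol, lamSymbol, norm_smul, Real.norm_of_nonneg ht.le,
    Real.mul_rpow ht.le (norm_nonneg _), Complex.ofReal_mul]

lemma contDiff_partialSymbol (l : Fin 2) : ContDiff ℝ 1 (partialSymbol l) := by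
  have h : ContDiff ℝ 1 fun ξ : Plane => ξ l := by fun_prop
  exact contDiff_const.mul (Complex.ofRealCLM.contDiff.comp h)

/-- The first order symbols that are allowed: smooth off the origin and homogeneous of degree
one. -/
structure IsHomogeneousOne (d : Plane → ℂ) : Prop where
  contDiffAt : ∀ ξ : Plane, ξ ≠ 0 → ContDiffAt ℝ 1 d ξ
  map_smul : ∀ t : ℝ, 0 < t → ∀ ξ, d (t • ξ) = t * d ξ

lemma isHomogeneousOne_lamSymbol : IsHomogeneousOne (lamSymbol 1) :=
  ⟨fun _ hξ => contDiffAt_lamSymbol 1 hξ, fun t ht ξ => by simp [lamSymbol_smul 1 ht]⟩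

lemma isHomogeneousOne_partialSymbol (l : Fin 2) : IsHomogeneousOne (partialSymbol l) :=
  ⟨fun _ _ => (contDiff_partialSymbol l).contDiffAt, fun t _ ξ => by
    simp [partialSymbol]; ring⟩

variable {φ : 𝓢(Plane, ℝ)}

lemma mem_annulus_zero {ξ : Plane} (h : ξ ∈ annulus 0) : 1 / 2 < ‖ξ‖ ∧ ‖ξ‖ < 2 := by
  have := h
  simp only [annulus, Set.mem_ofPred_eq] at this
  norm_num at this
  norm_num
  exact this

lemma smul_mem_annulus_iff (j : ℤ) (ξ : Plane) :
    (2 : ℝ) ^ (-j) • ξ ∈ annulus 0 ↔ ξ ∈ annulus j := by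
  have h : (0 : ℝ) < 2 ^ j := by positivity
  simp only [annulus, Set.mem_ofPred_eq, norm_smul, zpow_neg, norm_inv,
    Real.norm_of_nonneg h.le]
  rw [zpow_sub₀ two_ne_zero, zpow_sub₀ two_ne_zero, zpow_add₀ two_ne_zero, zpow_add₀ two_ne_zero,
    lt_inv_mul_iff₀ h, inv_mul_lt_iff₀ h]
  simp [div_eq_mul_inv]

lemma blockSymbol_eq_zero (hφ : IsLittlewoodPaley φ) {j : ℤ} {ξ : Plane} (hξ : ξ ∉ annulus j) :
    blockSymbol φ j ξ = 0 := by
  rw [← smul_mem_annulus_iff] at hξ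
  have : φ ((2 : ℝ) ^ (-j) • ξ) = 0 := image_eq_zero_of_notMem_tsupport fun h =>
    hξ (hφ.support h)
  rw [blockSymbol, this, Complex.ofReal_zero]

lemma opSymbol_eq_zero (hφ : IsLittlewoodPaley φ) (a : ℝ) (P d : Plane → ℂ) {j : ℤ} {ξ : Plane}
    (hξ : ξ ∉ annulus j) : opSymbol φ a P d j ξ = 0 := by
  simp [opSymbol, blockSymbol_eq_zero hφ hξ]

lemma SymbolBound.comp_smul {P : Plane → ℂ} {M : ℝ≥0} (h : SymbolBound P M) {t : ℝ} (ht : 0 < t) :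
    SymbolBound (fun ξ => P (t • ξ)) M := by
  have hne : ∀ ξ : Plane, ξ ≠ 0 → t • ξ ≠ 0 := fun ξ hξ => smul_ne_zero ht.ne' hξ
  refine ⟨fun ξ hξ => ?_, fun ξ hξ => h.bound _ (hne ξ hξ), fun ξ hξ => ?_⟩
  · exact (h.diff _ (hne ξ hξ)).comp ξ (by fun_prop)
  · rw [fderiv_comp_smul]
    have := h.gradient_bound _ (hne ξ hξ)
    rw [norm_smul, Real.norm_of_nonneg ht.le] at this ⊢
    linarith

lemma exists_lipschitz_opSymbol_zero (hφ : IsLittlewoodPaley φ) (a : ℝ) {d : Plane → ℂ}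
    (hd : IsHomogeneousOne d) :
    ∃ L : ℝ≥0, ∀ (P : Plane → ℂ) (M : ℝ≥0), SymbolBound P M → ∀ ξ ζ,
      ‖opSymbol φ a P d 0 ξ - opSymbol φ a P d 0 ζ‖ ≤ L * M * ‖ξ - ζ‖ := by
  let Q : Plane → ℂ := fun ξ => lamSymbol a ξ * d ξ * (φ ξ : ℂ)
  have hne : ∀ ξ ∈ tsupport φ, ξ ≠ 0 := by
    rintro ξ hξ rfl
    have := (mem_annulus_zero (hφ.support hξ)).1
    norm_num at this
  have hsupp : tsupport Q ⊆ tsupport φ := by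
    refine closure_mono fun ξ hξ => ?_
    rw [Function.mem_support] at hξ ⊢
    intro h
    exact hξ (by simp [Q, h])
  have hφc : HasCompactSupport φ := by
    refine HasCompactSupport.intro (isCompact_closedBall (0 : Plane) 2) fun ξ hξ => ?_
    refine image_eq_zero_of_notMem_tsupport fun h => hξ ?_
    simpa using (mem_annulus_zero (hφ.support h)).2.le
  have hQc : HasCompactSupport Q := hφc.of_isClosed_subset (isClosed_tsupport _) hsupp
  have hQ : ContDiff ℝ 1 Q := by
    refine contDiff_iff_contDiffAt.2 fun ξ => ?_
    by_cases hξ : ξ ∈ tsupport Q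
    swap
    · exact contDiffAt_const.congr_of_eventuallyEq (notMem_tsupport_iff_eventuallyEq.1 hξ)
    have h0 := hne ξ (hsupp hξ)
    exact ((contDiffAt_lamSymbol a h0).mul (hd.contDiffAt ξ h0)).mul
      (Complex.ofRealCLM.contDiff.comp (φ.smooth 1)).contDiffAt
  obtain ⟨B₀, hB₀⟩ := hQc.exists_bound_of_continuous hQ.continuous
  obtain ⟨B₁, hB₁⟩ := (hQc.fderiv (𝕜 := ℝ)).exists_bound_of_continuous
    (hQ.continuous_fderiv (by norm_num))
  have hB₀' : 0 ≤ B₀ := (norm_nonneg _).trans (hB₀ 0)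
  have hB₁' : 0 ≤ B₁ := (norm_nonneg _).trans (hB₁ 0)
  refine ⟨⟨B₁ + 2 * B₀, by positivity⟩, fun P M hP ξ ζ => ?_⟩
  have hop : opSymbol φ a P d 0 = fun ξ => P ξ * Q ξ := by
    ext ξ
    simp [opSymbol, blockSymbol, Q]; ring
  have hzero : ∀ ξ ∉ tsupport φ, (fun ξ => P ξ * Q ξ) =ᶠ[nhds ξ] fun _ => 0 := by
    intro ξ hξ
    filter_upwards [notMem_tsupport_iff_eventuallyEq.1 (fun h => hξ (hsupp h))] with x hx
    simp [hx]
  rw [hop]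
  have hdiff : ∀ ξ, DifferentiableAt ℝ (fun ξ => P ξ * Q ξ) ξ := by
    intro ξ
    by_cases hξ : ξ ∈ tsupport φ
    · exact (hP.diff ξ (hne ξ hξ)).mul (hQ.differentiable (by norm_num) ξ)
    · exact (differentiableAt_const 0).congr_of_eventuallyEq (hzero ξ hξ)
  have hbd : ∀ ξ, ‖fderiv ℝ (fun ξ => P ξ * Q ξ) ξ‖ ≤ (B₁ + 2 * B₀) * M := by
    intro ξ
    by_cases hξ : ξ ∈ tsupport φ
    · have h0 := hne ξ hξ
      have h1 := (mem_annulus_zero (hφ.support hξ)).1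
      rw [fderiv_fun_mul (hP.diff ξ h0) (hQ.differentiable (by norm_num) ξ)]
      have h2 : ‖fderiv ℝ P ξ‖ ≤ 2 * M := by
        have h3 := hP.gradient_bound ξ h0
        have h4 : 1 / 2 * ‖fderiv ℝ P ξ‖ ≤ ‖ξ‖ * ‖fderiv ℝ P ξ‖ := by gcongr
        linarith
      calc _ ≤ ‖P ξ‖ * ‖fderiv ℝ Q ξ‖ + ‖Q ξ‖ * ‖fderiv ℝ P ξ‖ := by
            refine (norm_add_le _ _).trans ?_
            rw [norm_smul, norm_smul]
        _ ≤ M * B₁ + B₀ * (2 * M) := by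
          gcongr
          · exact hP.bound ξ h0
          · exact hB₁ ξ
          · exact hB₀ ξ
        _ = _ := by ring
    · rw [(hzero ξ hξ).fderiv_eq]
      simp only [fderiv_fun_const, Pi.zero_apply, norm_zero]
      positivity
  exact convex_univ.norm_image_sub_le_of_norm_fderiv_le (𝕜 := ℝ) (fun x _ => hdiff x)
    (fun x _ => hbd x) (Set.mem_univ ζ) (Set.mem_univ ξ)

lemma opSymbol_eq_scale (a : ℝ) (P : Plane → ℂ) {d : Plane → ℂ} (hd : IsHomogeneousOne d)
    (j : ℤ) (ξ : Plane) :
    opSymbol φ a P d j ξ = ((((2 : ℝ) ^ j) ^ a * (2 : ℝ) ^ j : ℝ) : ℂ) *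
      opSymbol φ a (fun x => P ((2 : ℝ) ^ j • x)) d 0 ((2 : ℝ) ^ (-j) • ξ) := by
  have ht : (0 : ℝ) < 2 ^ j := by positivity
  have h1 : (2 : ℝ) ^ j • (2 : ℝ) ^ (-j) • ξ = ξ := by
    rw [smul_smul, zpow_neg, mul_inv_cancel₀ ht.ne', one_smul]
  conv_lhs => rw [opSymbol, ← h1, lamSymbol_smul a ht, hd.map_smul _ ht]
  simp only [opSymbol, blockSymbol, h1, neg_zero, zpow_zero, one_smul]
  push_cast
  ring

lemma exists_lipschitz_opSymbol (hφ : IsLittlewoodPaley φ) (a : ℝ) :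
    ∃ L : ℝ≥0, ∀ (P : Plane → ℂ) (M : ℝ≥0), SymbolBound P M →
      ∀ d : Plane → ℂ, (d = lamSymbol 1 ∨ ∃ l : Fin 2, d = partialSymbol l) → ∀ (j : ℤ) (ξ ζ),
      ‖opSymbol φ a P d j ξ - opSymbol φ a P d j ζ‖ ≤ L * M * ((2 : ℝ) ^ j) ^ a * ‖ξ - ζ‖ := by
  have key : ∀ d : Plane → ℂ, IsHomogeneousOne d → ∃ L : ℝ≥0, ∀ (P : Plane → ℂ) (M : ℝ≥0),
      SymbolBound P M → ∀ (j : ℤ) (ξ ζ),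
      ‖opSymbol φ a P d j ξ - opSymbol φ a P d j ζ‖ ≤ L * M * ((2 : ℝ) ^ j) ^ a * ‖ξ - ζ‖ := by
    intro d hd
    obtain ⟨L, hL⟩ := exists_lipschitz_opSymbol_zero hφ a hd
    refine ⟨L, fun P M hP j ξ ζ => ?_⟩
    have ht : (0 : ℝ) < 2 ^ j := by positivity
    have h := hL _ M (hP.comp_smul ht) ((2 : ℝ) ^ (-j) • ξ) ((2 : ℝ) ^ (-j) • ζ)
    rw [← smul_sub, norm_smul, zpow_neg, norm_inv, Real.norm_of_nonneg ht.le] at h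
    rw [opSymbol_eq_scale a P hd, opSymbol_eq_scale a P hd, ← mul_sub, norm_mul,
      Complex.norm_real, Real.norm_of_nonneg (by positivity), zpow_neg]
    calc _ ≤ ((2 : ℝ) ^ j) ^ a * (2 : ℝ) ^ j * (L * M * (((2 : ℝ) ^ j)⁻¹ * ‖ξ - ζ‖)) := by
          gcongr
      _ = _ := by field_simp
  obtain ⟨L₁, h₁⟩ := key _ isHomogeneousOne_lamSymbol
  choose L₂ h₂ using fun l => key _ (isHomogeneousOne_partialSymbol l)
  refine ⟨L₁ + ∑ l, L₂ l, fun P M hP d hd j ξ ζ => ?_⟩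
  rcases hd with rfl | ⟨l, rfl⟩
  · refine (h₁ P M hP j ξ ζ).trans ?_
    gcongr
    exact le_self_add
  · refine (h₂ l P M hP j ξ ζ).trans ?_
    gcongr
    exact (Finset.single_le_sum (fun _ _ => zero_le) (Finset.mem_univ l)).trans le_add_self

lemma measurableSet_annulus (j : ℤ) : MeasurableSet (annulus j) :=
  (isOpen_lt continuous_const continuous_norm).measurableSet.inter
    (isOpen_lt continuous_norm continuous_const).measurableSet

/-- At most two of the annuli `𝒜_j` meet at a point. -/
lemma tsum_annulus_le {f : Plane → ℝ≥0∞} (hf : Measurable f) :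
    ∑' j : ℤ, ∫⁻ ξ in annulus j, f ξ ≤ 2 * ∫⁻ ξ, f ξ := by
  simp_rw [← lintegral_indicator (measurableSet_annulus _)]
  rw [← lintegral_tsum fun j => (hf.indicator (measurableSet_annulus j)).aemeasurable,
    ← lintegral_const_mul _ hf]
  refine lintegral_mono_ae (ae_ne_zero.mono fun ξ hξ => ?_)
  obtain ⟨n, hn1, hn2⟩ := exists_mem_Ico_zpow (norm_pos_iff.2 hξ) (one_lt_two (α := ℝ))
  have h : ∀ j ∉ ({n, n + 1} : Finset ℤ), (annulus j).indicator f ξ = 0 := by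
    intro j hj
    refine Set.indicator_of_notMem (fun h => hj ?_) f
    have h1 := (zpow_lt_zpow_iff_right₀ (one_lt_two (α := ℝ))).1 (h.1.trans hn2)
    have h2 := (zpow_lt_zpow_iff_right₀ (one_lt_two (α := ℝ))).1 (hn1.trans_lt h.2)
    have : j = n ∨ j = n + 1 := by omega
    simpa using this
  rw [tsum_eq_sum h, Finset.sum_pair (by omega), two_mul]
  exact add_le_add (Set.indicator_le_self _ _ _) (Set.indicator_le_self _ _ _)

/-- `v` is the sum of a bounded and a square integrable function. -/
def LInfAddL2 (v : Plane → ℂ) : Prop :=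
  ∃ v₁ v₂ : Plane → ℂ, MemLp v₁ ∞ ∧ MemLp v₂ 2 ∧ ∀ x, v x = v₁ x + v₂ x

lemma LInfAddL2.exists_represents_mul {v u : Plane → ℂ} (hv : LInfAddL2 v) (hu : MemLp u 2) :
    ∃ T : 𝓢'(Plane, ℂ), Represents (fun x => v x * u x) T := by
  obtain ⟨v₁, v₂, h₁, h₂, hsum⟩ := hv
  have i₁ : MemLp (fun x => v₁ x * u x) 2 := hu.mul h₁
  have i₂ : MemLp (fun x => v₂ x * u x) 1 := hu.mul h₂
  obtain ⟨T₁, hT₁⟩ := exists_represents i₁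
  obtain ⟨T₂, hT₂⟩ := exists_represents i₂
  refine ⟨T₁ + T₂, ?_⟩
  simp_rw [hsum, add_mul]
  exact hT₁.add hT₂

section Admissible

variable {T : 𝓢'(Plane, ℂ)} {w : Plane → ℂ} {σ : ℝ}

lemma setLIntegral_compl_ball_le (hσ : 0 ≤ σ) (W : Plane → ℝ≥0∞) :
    ∫⁻ ξ in (Metric.closedBall (0 : Plane) 1)ᶜ, W ξ ^ 2 ≤ ∫⁻ ξ, wt (2 * σ) ξ * W ξ ^ 2 := by
  refine (setLIntegral_mono' measurableSet_closedBall.compl fun ξ hξ => ?_).trans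
    (setLIntegral_le_lintegral _ _)
  have h1 : 1 ≤ ‖ξ‖ := by
    simp only [Set.mem_compl_iff, Metric.mem_closedBall, dist_zero_right, not_le] at hξ
    exact hξ.le
  have h2 : 1 ≤ wt (2 * σ) ξ := by
    rw [wt, ENNReal.one_le_ofReal]
    exact Real.one_le_rpow h1 (by positivity)
  exact le_mul_of_one_le_left (by positivity) h2

/-- A distribution in `Ḣ^σ`, `σ ≥ 0`, is square integrable. -/
lemma MemHdot.exists_memLp (h : MemHdot σ T) (hσ : 0 ≤ σ) :
    ∃ F : Plane → ℂ, Measurable F ∧ Represents F (𝓕 T) ∧ MemLp F 2 := by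
  obtain ⟨⟨w, hw, hloc⟩, hn⟩ := h
  obtain ⟨F, mF, hwF, hF⟩ := hw.exists_measurable
  refine ⟨F, mF, hF, (memLp_two_iff mF.aestronglyMeasurable).2 ?_⟩
  have h1 : ∫⁻ ξ in Metric.closedBall (0 : Plane) 1, ‖F ξ‖ₑ ^ 2 < ∞ := by
    have h2 : MemLp F 2 (volume.restrict (Metric.closedBall (0 : Plane) 1)) :=
      (memLp_congr_ae (ae_restrict_of_ae hwF)).1 (hloc _ (isCompact_closedBall 0 1))
    have h3 := (eLpNorm_lt_top_iff_lintegral_rpow_enorm_lt_top two_ne_zero (by simp)).1 h2.2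
    simpa using h3
  have h2 := setLIntegral_compl_ball_le hσ (fun ξ => ‖F ξ‖ₑ)
  rw [← hdotNorm_sq hF] at h2
  rw [← lintegral_add_compl _ (measurableSet_closedBall (x := (0 : Plane)) (ε := 1))]
  exact ENNReal.add_lt_top.2 ⟨h1, h2.trans_lt (ENNReal.pow_lt_top hn)⟩

/-- A locally integrable function with `|ξ|^σ w ∈ L²` for some `σ ≥ 0` is the sum of an integrable
and a square integrable function. -/
lemma exists_split (hT : Represents w T) (mw : Measurable w) (hσ : 0 ≤ σ)
    (h : ∫⁻ ξ, wt (2 * σ) ξ * ‖w ξ‖ₑ ^ 2 < ∞) :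
    L1AddL2 (fun ξ => ‖w ξ‖ₑ) ∧ ∃ v, FourierDual v w ∧ LInfAddL2 v := by
  set B := Metric.closedBall (0 : Plane) 1
  have mB : MeasurableSet B := measurableSet_closedBall
  have h1 : Integrable (B.indicator w) :=
    (integrable_indicator_iff mB).2
      ((locallyIntegrable_iff.1 hT.locallyIntegrable) B (isCompact_closedBall 0 1))
  have h2' : ∫⁻ ξ, ‖Bᶜ.indicator w ξ‖ₑ ^ 2 < ∞ := by
    have e : ∀ ξ, ‖Bᶜ.indicator w ξ‖ₑ ^ 2 = Bᶜ.indicator (fun ξ => ‖w ξ‖ₑ ^ 2) ξ := fun ξ => by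
      by_cases hξ : ξ ∈ Bᶜ
      · rw [Set.indicator_of_mem hξ, Set.indicator_of_mem hξ]
      · rw [Set.indicator_of_notMem hξ, Set.indicator_of_notMem hξ]; simp
    simp_rw [e]
    rw [lintegral_indicator mB.compl]
    exact (setLIntegral_compl_ball_le hσ _).trans_lt h
  have h2 : MemLp (Bᶜ.indicator w) 2 :=
    (memLp_two_iff (mw.indicator mB.compl).aestronglyMeasurable).2 h2'
  have hsum : ∀ ξ, w ξ = B.indicator w ξ + Bᶜ.indicator w ξ := fun ξ =>
    (congrFun (Set.indicator_self_add_compl B w) ξ).symm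
  refine ⟨⟨fun ξ => ‖B.indicator w ξ‖ₑ, fun ξ => ‖Bᶜ.indicator w ξ‖ₑ, (mw.indicator mB).enorm,
    (mw.indicator mB.compl).enorm, fun ξ => ?_, h1.2, h2'⟩, ?_⟩
  · simp only
    conv_lhs => rw [hsum]
    exact enorm_add_le _ _
  · refine ⟨fun x => 𝓕⁻ (B.indicator w) x + invL2 _ h2 x, ?_, 𝓕⁻ (B.indicator w), invL2 _ h2,
      ?_, memLp_invL2 h2, fun _ => rfl⟩
    · have h := (fourierDual_of_integrable h1).add (fourierDual_invL2 h2)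
      simp_rw [← hsum] at h
      exact h
    · exact memLp_top_of_bound (continuous_fourierInv_of_integrable h1).aestronglyMeasurable _
        (Filter.Eventually.of_forall norm_fourierInv_le)

lemma lintegral_wt_mul_sq (w : Plane → ℂ) (σ τ : ℝ) :
    ∫⁻ ξ, wt σ ξ * (wt τ ξ * ‖w ξ‖ₑ) ^ 2 = ∫⁻ ξ, wt (σ + 2 * τ) ξ * ‖w ξ‖ₑ ^ 2 := by
  refine lintegral_congr_ae (ae_ne_zero.mono fun ξ hξ => ?_)
  simp only
  rw [mul_pow, wt_sq, ← mul_assoc, ← wt_add hξ]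

lemma Admissible.exists_represents {s ν : ℝ} (hs : 0 ≤ s) (hν : ν ≤ 1) {f g : 𝓢'(Plane, ℂ)}
    (h : Admissible s ν f g) :
    (∃ F : Plane → ℂ, Measurable F ∧ Represents F (𝓕 f) ∧ MemLp F 2) ∧
    ∃ w : Plane → ℂ, Measurable w ∧ Represents w (𝓕 g) ∧ L1AddL2 (fun ξ => ‖w ξ‖ₑ) ∧
      ∃ v, FourierDual v w ∧ LInfAddL2 v := by
  have hg : ∀ {σ : ℝ}, 0 ≤ σ → MemHdot σ g → ∃ w : Plane → ℂ, Measurable w ∧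
      Represents w (𝓕 g) ∧ L1AddL2 (fun ξ => ‖w ξ‖ₑ) ∧ ∃ v, FourierDual v w ∧ LInfAddL2 v := by
    intro σ hσ hg
    obtain ⟨w, mw, hw, -⟩ := hg.exists_memLp hσ
    refine ⟨w, mw, hw, exists_split hw mw hσ ?_⟩
    rw [← hdotNorm_sq hw]
    exact ENNReal.pow_lt_top hg.2
  have hG : ∀ {σ : ℝ} {G : 𝓢'(Plane, ℂ)}, 0 ≤ σ → IsMultiplier (lamSymbol 1) g G → MemHdot σ G →
      ∃ w : Plane → ℂ, Measurable w ∧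
      Represents w (𝓕 g) ∧ L1AddL2 (fun ξ => ‖w ξ‖ₑ) ∧ ∃ v, FourierDual v w ∧ LInfAddL2 v := by
    rintro σ G hσ ⟨w₀, hw₀, hG₀⟩ hG
    obtain ⟨w, mw, hww, hw⟩ := hw₀.exists_measurable
    have hG₁ : Represents (fun ξ => lamSymbol 1 ξ * w ξ) (𝓕 G) := by
      refine hG₀.congr ?_
      filter_upwards [hww] with ξ hξ
      rw [hξ]
    refine ⟨w, mw, hw, exists_split (σ := σ + 1) hw mw (by positivity) ?_⟩
    have h1 := hdotNorm_sq hG₁ σ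
    simp_rw [lamSymbol, enorm_weight_mul, lintegral_wt_mul_sq] at h1
    rw [show 2 * (σ + 1) = 2 * σ + 2 * 1 by ring, ← h1]
    exact ENNReal.pow_lt_top hG.2
  have hν' : 0 ≤ 1 - ν := by linarith
  rcases h with (⟨h1, h2⟩ | ⟨h1, h2⟩) | ⟨G, hgG, ⟨⟨-, h1⟩, h2⟩ | ⟨h1, -, h2⟩⟩
  · exact ⟨h1.exists_memLp hν', hg (by positivity) h2⟩
  · exact ⟨h1.exists_memLp hs, hg (by linarith) h2⟩
  · exact ⟨h1.exists_memLp zero_le_one, hG hs hgG h2⟩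
  · exact ⟨h1.exists_memLp hs, hG zero_le_one hgG h2⟩

end Admissible

lemma integrable_translate_mul {F w : Plane → ℂ} (mF : Measurable F) (mw : Measurable w)
    {ξ : Plane} (h : cv (fun η => ‖F η‖ₑ) (fun η => ‖w η‖ₑ) ξ < ∞) :
    Integrable fun η => F (ξ - η) * w η := by
  refine ⟨(by fun_prop : Measurable fun η => F (ξ - η) * w η).aestronglyMeasurable, ?_⟩
  simp_rw [HasFiniteIntegral, enorm_mul]
  exact h

/-- The commutator of a compactly supported bounded multiplier with `g` is well defined, and its
Fourier transform is a square integrable function. -/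
lemma exists_isCommutator {m F w v : Plane → ℂ} {f g : 𝓢'(Plane, ℂ)} (mm : Measurable m)
    {B : ℝ≥0} (hB : ∀ ξ, ‖m ξ‖ₑ ≤ B) {S : Set Plane} (mS : MeasurableSet S) (hS : volume S < ∞)
    (hmS : ∀ ξ ∉ S, m ξ = 0)
    (mF : Measurable F) (hF : Represents F (𝓕 f)) (hF2 : MemLp F 2)
    (mw : Measurable w) (hg : Represents w (𝓕 g)) (hw : L1AddL2 fun ξ => ‖w ξ‖ₑ)
    (hvw : FourierDual v w) (hv : LInfAddL2 v) :
    ∃ (K : 𝓢'(Plane, ℂ)) (κ : Plane → ℂ), IsCommutator m g f K ∧ Measurable κ ∧ MemLp κ 2 ∧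
      Represents κ (𝓕 K) ∧ ∀ᵐ ξ ∂(volume.restrict S),
        ‖κ ξ‖ₑ ≤ ∫⁻ η, ‖m ξ - m (ξ - η)‖ₑ * (‖F (ξ - η)‖ₑ * ‖w η‖ₑ) := by
  have lF2 : ∫⁻ ξ, ‖F ξ‖ₑ ^ 2 < ∞ := (memLp_two_iff hF2.1).1 hF2
  have hcvS := setLIntegral_sq_cv_lt_top (F := fun η => ‖F η‖ₑ) (by fun_prop) hw lF2 hS
  set mF' : Plane → ℂ := fun ξ => m ξ * F ξ with hmF'
  have mmF : Measurable mF' := mm.mul mF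
  have lmF2 : ∫⁻ ξ, ‖mF' ξ‖ₑ ^ 2 < ∞ := by
    calc _ ≤ ∫⁻ ξ, (B : ℝ≥0∞) ^ 2 * ‖F ξ‖ₑ ^ 2 := by
          refine lintegral_mono fun ξ => ?_
          rw [hmF', enorm_mul, ← mul_pow]
          gcongr
          exact hB ξ
      _ = (B : ℝ≥0∞) ^ 2 * ∫⁻ ξ, ‖F ξ‖ₑ ^ 2 := lintegral_const_mul _ (by fun_prop)
      _ < ∞ := ENNReal.mul_lt_top (by simp) lF2
  have hmF2 : MemLp mF' 2 := (memLp_two_iff mmF.aestronglyMeasurable).2 lmF2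
  have lmF1 : ∫⁻ ξ, ‖mF' ξ‖ₑ < ∞ := by
    have e : ∀ ξ, ‖mF' ξ‖ₑ = S.indicator 1 ξ * ‖mF' ξ‖ₑ := fun ξ => by
      by_cases hξ : ξ ∈ S
      · simp [hξ]
      · have hz : mF' ξ = 0 := by simp only [hmF', hmS ξ hξ, zero_mul]
        rw [hz, enorm_zero, mul_zero]
    rw [lintegral_congr e]
    refine lintegral_mul_lt_top (measurable_one.indicator mS) (by fun_prop) ?_ lmF2
    have e2 : ∀ ξ, (S.indicator (1 : Plane → ℝ≥0∞) ξ) ^ 2 = S.indicator 1 ξ := fun ξ => by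
      by_cases hξ : ξ ∈ S <;> simp [hξ]
    simp_rw [e2]
    rw [lintegral_indicator_one mS]
    exact hS
  have hcvm := lintegral_sq_cv_lt_top (F := fun η => ‖mF' η‖ₑ) (by fun_prop) hw lmF2 lmF1
  have hu := memLp_invL2 hF2
  have huF := fourierDual_invL2 hF2
  have hp := memLp_invL2 hmF2
  have hpF := fourierDual_invL2 hmF2
  obtain ⟨gf, hgf⟩ := hv.exists_represents_mul hu
  have hgf' := represents_fourier_mul hvw huF hu hF2 mF mw hw hgf
  set α : Plane → ℂ := fun ξ => m ξ * ccv F w ξ with hα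
  have mα : Measurable α := mm.mul (measurable_ccv mF mw)
  have hα2 : MemLp α 2 := by
    refine (memLp_two_iff mα.aestronglyMeasurable).2 ?_
    calc _ ≤ ∫⁻ ξ in S, (B : ℝ≥0∞) ^ 2 * cv (fun η => ‖F η‖ₑ) (fun η => ‖w η‖ₑ) ξ ^ 2 := by
          rw [← lintegral_indicator mS]
          refine lintegral_mono fun ξ => ?_
          by_cases hξ : ξ ∈ S
          · rw [Set.indicator_of_mem hξ, hα, enorm_mul, ← mul_pow]
            gcongr
            · exact hB ξ
            · exact enorm_ccv_le F w ξ
          · simp [hα, hmS ξ hξ]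
      _ = (B : ℝ≥0∞) ^ 2 * ∫⁻ ξ in S, cv (fun η => ‖F η‖ₑ) (fun η => ‖w η‖ₑ) ξ ^ 2 :=
        lintegral_const_mul' _ _ (by simp)
      _ < ∞ := ENNReal.mul_lt_top (by simp) hcvS
  obtain ⟨A', hA'⟩ := exists_represents hα2
  have hA : Represents α (𝓕 (𝓕⁻ A')) := by rwa [fourier_fourierInv_eq]
  obtain ⟨mf', hmf'⟩ := exists_represents hmF2
  have hmf : Represents mF' (𝓕 (𝓕⁻ mf')) := by rwa [fourier_fourierInv_eq]
  obtain ⟨P, hP⟩ := hv.exists_represents_mul hp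
  have hP' := represents_fourier_mul hvw hpF hp hmF2 mmF mw hw hP
  have mβ : Measurable (ccv mF' w) := measurable_ccv mmF mw
  have hβ2 : MemLp (ccv mF' w) 2 := by
    refine (memLp_two_iff mβ.aestronglyMeasurable).2 (lt_of_le_of_lt ?_ hcvm)
    refine lintegral_mono fun ξ => ?_
    gcongr
    exact enorm_ccv_le mF' w ξ
  refine ⟨𝓕⁻ A' - P, fun ξ => α ξ - ccv mF' w ξ, ?_, mα.sub mβ, hα2.sub hβ2, ?_, ?_⟩
  · exact ⟨gf, 𝓕⁻ A', 𝓕⁻ mf', P, ⟨v, _, hvw.represents hg, huF.represents hF, hgf⟩,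
      ⟨_, hgf', hA⟩, ⟨F, hF, hmf⟩, ⟨v, _, hvw.represents hg, hpF.represents hmf, hP⟩, rfl⟩
  · have : 𝓕 (𝓕⁻ A' - P) = 𝓕 (𝓕⁻ A') - 𝓕 P := map_sub (fourierCLM ℂ 𝓢'(Plane, ℂ)) _ _
    rw [this]
    exact hA.sub hP'
  · have hfin := ae_lt_top (by fun_prop) hcvS.ne
    filter_upwards [hfin] with ξ hξ
    have hξ' : cv (fun η => ‖F η‖ₑ) (fun η => ‖w η‖ₑ) ξ < ∞ :=
      (ENNReal.pow_lt_top_iff.1 hξ).resolve_right two_ne_zero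
    have i1 := integrable_translate_mul mF mw hξ'
    have i2 : Integrable fun η => mF' (ξ - η) * w η := by
      refine integrable_translate_mul mmF mw (lt_of_le_of_lt ?_
        (ENNReal.mul_lt_top (ENNReal.coe_lt_top (r := B)) hξ'))
      unfold cv
      rw [← lintegral_const_mul _ (by fun_prop)]
      refine lintegral_mono fun η => ?_
      simp only [hmF', enorm_mul]
      rw [← mul_assoc]
      gcongr
      exact hB _
    have e : α ξ - ccv mF' w ξ = ∫ η, (m ξ - m (ξ - η)) * (F (ξ - η) * w η) := by
      simp only [hα, ccv]
      rw [← integral_const_mul, ← integral_sub (i1.const_mul _) i2]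
      congr 1 with η
      simp only [hmF']
      ring
    rw [e]
    refine (enorm_integral_le_lintegral_enorm _).trans_eq ?_
    simp_rw [enorm_mul]

lemma annulus_subset_closedBall (j : ℤ) :
    annulus j ⊆ Metric.closedBall (0 : Plane) (2 ^ (j + 1)) := fun ξ hξ => by
  simpa using hξ.2.le

lemma volume_annulus_lt_top (j : ℤ) : volume (annulus j) < ∞ :=
  (measure_mono (annulus_subset_closedBall j)).trans_lt measure_closedBall_lt_top

lemma le_of_sq_le_sq {x y : ℝ≥0∞} (h : x ^ 2 ≤ y ^ 2) : x ≤ y :=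
  (ENNReal.pow_le_pow_left_iff two_ne_zero).1 h

lemma ne_zero_of_mem_annulus {j : ℤ} {ξ : Plane} (h : ξ ∈ annulus j) : ξ ≠ 0 := by
  rintro rfl
  have h1 := h.1
  rw [norm_zero] at h1
  exact absurd h1 (not_lt.2 (by positivity))

/-- The pairing of a distribution with square integrable Fourier transform and a distribution
whose frequencies lie in an annulus. -/
lemma exists_isPairing {K h : 𝓢'(Plane, ℂ)} {κ : Plane → ℂ} (mκ : Measurable κ)
    (hκ2 : MemLp κ 2) (hκ : Represents κ (𝓕 K)) {j : ℤ} {ρ : ℝ}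
    (hsupp : FourierSupportedIn h (annulus j)) (hh : MemHdot ρ h) :
    ∃ z : ℂ, IsPairing K h z ∧ ∀ σ : ℝ, ‖z‖ₑ ^ 2 ≤
      (∫⁻ ξ in annulus j, wt (-(2 * σ)) ξ * ‖κ ξ‖ₑ ^ 2) * hdotNorm σ h ^ 2 := by
  obtain ⟨w₀, hw₀, hz₀⟩ := hsupp
  obtain ⟨w, mw, hww, hw⟩ := hw₀.exists_measurable
  have hz : ∀ᵐ ξ, ξ ∉ annulus j → w ξ = 0 := by
    filter_upwards [hz₀, hww] with ξ h1 h2 h3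
    rw [← h2, h1 h3]
  have hw2 : MemLp w 2 := by
    obtain ⟨⟨w₁, hw₁, hloc⟩, -⟩ := hh
    have h1 : MemLp w 2 (volume.restrict (Metric.closedBall (0 : Plane) (2 ^ (j + 1)))) :=
      (memLp_congr_ae (ae_restrict_of_ae (hw₁.ae_eq hw))).1 (hloc _ (isCompact_closedBall 0 _))
    have h2 := (memLp_indicator_iff_restrict measurableSet_closedBall).2 h1
    refine (memLp_congr_ae ?_).1 h2
    filter_upwards [hz] with ξ hξ
    by_cases hm : ξ ∈ Metric.closedBall (0 : Plane) (2 ^ (j + 1))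
    · rw [Set.indicator_of_mem hm]
    · rw [Set.indicator_of_notMem hm, hξ fun h => hm (annulus_subset_closedBall j h)]
  refine ⟨∫ ξ, κ ξ * conj (w ξ), ⟨invL2 κ hκ2, invL2 w hw2, (fourierDual_invL2 hκ2).represents hκ,
    (fourierDual_invL2 hw2).represents hw,
    (memLp_invL2 hκ2).integrable_mul (memLp_invL2 hw2).star,
    (integral_invL2_mul_conj hκ2 hw2).symm⟩, fun σ => ?_⟩
  have h1 : ‖∫ ξ, κ ξ * conj (w ξ)‖ₑ ≤ ∫⁻ ξ in annulus j, ‖κ ξ‖ₑ * ‖w ξ‖ₑ := by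
    refine (enorm_integral_le_lintegral_enorm _).trans ?_
    rw [← lintegral_indicator (measurableSet_annulus j)]
    refine lintegral_mono_ae ?_
    filter_upwards [hz] with ξ hξ
    by_cases hm : ξ ∈ annulus j
    · rw [Set.indicator_of_mem hm, enorm_mul, RCLike.enorm_conj]
    · rw [hξ hm]; simp
  calc _ ≤ (∫⁻ ξ in annulus j, ‖κ ξ‖ₑ * ‖w ξ‖ₑ) ^ 2 := pow_le_pow_left' h1 2
    _ ≤ _ := sq_setLIntegral_mul_le_wt σ (by fun_prop) (by fun_prop)
    _ ≤ _ := by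
      rw [hdotNorm_sq hw]
      gcongr
      exact Measure.restrict_le_self

/-- The product estimates for the Fourier transforms of `f` and `Λg`. -/
lemma exists_lintegral_cv_le {s ν : ℝ} (hs : s ∈ Set.Ico (0 : ℝ) 1) (hν : ν ∈ Set.Ioo (0 : ℝ) 1) :
    ∃ C : ℝ≥0, ∀ (f g : 𝓢'(Plane, ℂ)) (F w : Plane → ℂ), Measurable F → Measurable w →
      Represents F (𝓕 f) → Represents w (𝓕 g) →
      (∫⁻ ξ, wt (2 * (s - ν)) ξ * cv (fun η => ‖F η‖ₑ) (fun η => wt 1 η * ‖w η‖ₑ) ξ ^ 2 ≤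
        C * (min (hdotNorm (1 - ν) f * hdotNorm (s + 1) g)
          (hdotNorm s f * hdotNorm (2 - ν) g)) ^ 2) ∧
      (∫⁻ ξ, wt (2 * s) ξ * cv (fun η => ‖F η‖ₑ) (fun η => wt 1 η * ‖w η‖ₑ) ξ ^ 2 ≤
        C * (min ((fourierNorm 1 0 f + hdotNorm 1 f) * hdotNorm (s + 1) g)
          ((fourierNorm 1 1 g + hdotNorm 2 g) * hdotNorm s f)) ^ 2) := by
  obtain ⟨hs0, hs1⟩ := hs
  obtain ⟨hν0, hν1⟩ := hν
  obtain ⟨C₁, h₁⟩ := exists_lintegral_wt_sq_cv_le (a := 1 - ν) (b := s) (by linarith) hs1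
    (by linarith)
  obtain ⟨C₂, h₂⟩ := exists_lintegral_wt_sq_cv_le (a := s) (b := 1 - ν) hs1 (by linarith)
    (by linarith)
  obtain ⟨C₃, h₃⟩ := exists_lintegral_wt_sq_cv_le_of_l1 hs0 hs1
  refine ⟨max (max C₁ C₂) C₃, fun f g F w mF mw hF hw => ?_⟩
  have mF' : Measurable fun η => ‖F η‖ₑ := by fun_prop
  have mH : Measurable fun η => wt 1 η * ‖w η‖ₑ := by fun_prop
  have e₁ := h₁ _ _ mF' mH
  have e₂ := h₂ _ _ mF' mH
  have e₃ := h₃ _ _ mF' mH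
  have e₄ := h₃ _ _ mH mF'
  simp only [lintegral_wt_mul_sq] at e₁ e₂ e₃ e₄
  rw [show 2 * s + 2 * 1 = 2 * (s + 1) by ring, ← hdotNorm_sq hF, ← hdotNorm_sq hw,
    show 1 - ν + s - 1 = s - ν by ring] at e₁
  rw [show 2 * (1 - ν) + 2 * 1 = 2 * (2 - ν) by ring, ← hdotNorm_sq hF, ← hdotNorm_sq hw,
    show s + (1 - ν) - 1 = s - ν by ring] at e₂
  have n2 : ∀ ξ : Plane, wt 2 ξ = wt (2 * 1) ξ := fun ξ => by rw [mul_one]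
  simp_rw [n2] at e₃
  rw [show 2 * s + 2 * 1 = 2 * (s + 1) by ring, ← hdotNorm_sq hF, ← hdotNorm_sq hw] at e₃
  rw [show (2 : ℝ) + 2 * 1 = 2 * 2 by ring, ← hdotNorm_sq hF, ← hdotNorm_sq hw, cv_comm,
    ← fourierNorm_one hw] at e₄
  have e₃' : ∫⁻ ξ, ‖F ξ‖ₑ = fourierNorm 1 0 f := by
    rw [fourierNorm_one hF]; simp
  rw [e₃'] at e₃
  have hsq : ∀ x y : ℝ≥0∞, x ^ 2 + y ^ 2 ≤ (x + y) ^ 2 := fun x y => by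
    rw [add_sq]
    gcongr
    exact le_self_add
  have hC₁ : C₁ ≤ max (max C₁ C₂) C₃ := (le_max_left _ _).trans (le_max_left _ _)
  have hC₂ : C₂ ≤ max (max C₁ C₂) C₃ := (le_max_right _ _).trans (le_max_left _ _)
  have hC₃ : C₃ ≤ max (max C₁ C₂) C₃ := le_max_right _ _
  constructor
  · rcases min_choice (hdotNorm (1 - ν) f * hdotNorm (s + 1) g)
      (hdotNorm s f * hdotNorm (2 - ν) g) with h | h <;> rw [h, mul_pow]
    · exact e₁.trans (by gcongr)
    · exact e₂.trans (by gcongr)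
  · rcases min_choice ((fourierNorm 1 0 f + hdotNorm 1 f) * hdotNorm (s + 1) g)
      ((fourierNorm 1 1 g + hdotNorm 2 g) * hdotNorm s f) with h | h <;> rw [h, mul_pow]
    · refine e₃.trans ?_
      gcongr
      exact hsq _ _
    · refine e₄.trans ?_
      gcongr
      exact hsq _ _

/-- A sequence whose squares sum to at most `Y²` is `Y` times a sequence in the unit ball of
`ℓ²`. -/
lemma exists_seq_of_tsum_le {D : ℤ → ℝ≥0∞} {Y : ℝ≥0∞} (h : ∑' j, D j ≤ Y ^ 2) :
    ∃ c : ℤ → ℝ≥0, ∑' j, (c j : ℝ≥0∞) ^ 2 ≤ 1 ∧ ∀ j, D j ≤ Y ^ 2 * (c j : ℝ≥0∞) ^ 2 := by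
  rcases eq_or_ne Y 0 with rfl | hY0
  · refine ⟨0, by simp, fun j => ?_⟩
    have := (ENNReal.le_tsum j).trans h
    simpa using this
  rcases eq_or_ne Y ∞ with rfl | hYt
  · obtain ⟨c, hc0, hc⟩ := ENNReal.exists_pos_sum_of_countable one_ne_zero ℤ
    refine ⟨c, ?_, fun j => ?_⟩
    · refine le_trans (ENNReal.tsum_le_tsum fun j => ?_) hc.le
      have h1 : (c j : ℝ≥0∞) ≤ 1 := (ENNReal.le_tsum j).trans hc.le
      calc (c j : ℝ≥0∞) ^ 2 = c j * c j := sq _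
        _ ≤ c j * 1 := by gcongr
        _ = c j := mul_one _
    · have : (c j : ℝ≥0∞) ^ 2 ≠ 0 := by simpa using (hc0 j).ne'
      rw [ENNReal.top_pow two_ne_zero, ENNReal.top_mul this]
      exact le_top
  have hY2 : Y ^ 2 ≠ 0 := pow_ne_zero 2 hY0
  have hY2t : Y ^ 2 ≠ ∞ := ENNReal.pow_ne_top hYt
  have hD : ∀ j, D j ≠ ∞ := fun j => (((ENNReal.le_tsum j).trans h).trans_lt
    (lt_top_iff_ne_top.2 hY2t)).ne
  have hc : ∀ j, ((NNReal.sqrt (D j / Y ^ 2).toNNReal : ℝ≥0) : ℝ≥0∞) ^ 2 = D j / Y ^ 2 := by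
    intro j
    rw [← ENNReal.coe_pow, NNReal.sq_sqrt, ENNReal.coe_toNNReal (ENNReal.div_ne_top (hD j) hY2)]
  refine ⟨fun j => NNReal.sqrt (D j / Y ^ 2).toNNReal, ?_, fun j => ?_⟩
  · simp_rw [hc, div_eq_mul_inv]
    rw [ENNReal.tsum_mul_right, ← div_eq_mul_inv]
    exact ENNReal.div_le_of_le_mul (by rwa [one_mul])
  · rw [hc, ENNReal.mul_div_cancel hY2 hY2t]

/-- The sum over the annuli of the local norms of the commutators. -/
lemma tsum_setLIntegral_le {a τ L M : ℝ} (hL : 0 ≤ L * M) {κ : ℤ → Plane → ℂ}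
    {V : Plane → ℝ≥0∞} (mV : Measurable V) (σ : ℝ) (hτ : τ = a - σ)
    (hκ : ∀ j, ∀ᵐ ξ ∂(volume.restrict (annulus j)),
      ‖κ j ξ‖ₑ ≤ ENNReal.ofReal (L * M * ((2 : ℝ) ^ j) ^ a) * V ξ) :
    ∑' j, ∫⁻ ξ in annulus j, wt (-(2 * σ)) ξ * ‖κ j ξ‖ₑ ^ 2 ≤
      2 * ENNReal.ofReal (2 ^ |a| * (L * M)) ^ 2 * ∫⁻ ξ, wt (2 * τ) ξ * V ξ ^ 2 := by
  have key : ∀ j, ∫⁻ ξ in annulus j, wt (-(2 * σ)) ξ * ‖κ j ξ‖ₑ ^ 2 ≤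
      ENNReal.ofReal (2 ^ |a| * (L * M)) ^ 2 * ∫⁻ ξ in annulus j, wt (2 * τ) ξ * V ξ ^ 2 := by
    intro j
    rw [← lintegral_const_mul _ (by fun_prop)]
    refine lintegral_mono_ae ?_
    filter_upwards [hκ j, ae_restrict_mem (measurableSet_annulus j)] with ξ h1 hξ
    have hξ0 := ne_zero_of_mem_annulus hξ
    have h2 : ((2 : ℝ) ^ j) ^ a ≤ 2 ^ |a| * ‖ξ‖ ^ a := by
      refine rpow_le_of_comparable (by positivity) (norm_nonneg _) (by norm_num) a ?_ ?_
      · have := hξ.1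
        rw [zpow_sub₀ two_ne_zero, zpow_one] at this
        linarith
      · have := hξ.2
        rw [zpow_add₀ two_ne_zero, zpow_one] at this
        linarith
    have h3 : ENNReal.ofReal (L * M * ((2 : ℝ) ^ j) ^ a) ≤
        ENNReal.ofReal (2 ^ |a| * (L * M)) * wt a ξ := by
      rw [wt, ← ENNReal.ofReal_mul (by positivity)]
      refine ENNReal.ofReal_le_ofReal ?_
      calc _ ≤ L * M * (2 ^ |a| * ‖ξ‖ ^ a) := by gcongr
        _ = _ := by ring
    calc _ ≤ wt (-(2 * σ)) ξ *
          ((ENNReal.ofReal (2 ^ |a| * (L * M)) * wt a ξ) * V ξ) ^ 2 := by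
          gcongr
          exact h1.trans (by gcongr)
      _ = ENNReal.ofReal (2 ^ |a| * (L * M)) ^ 2 * ((wt (-(2 * σ)) ξ * wt a ξ ^ 2) * V ξ ^ 2) := by
        ring
      _ = _ := by
        rw [wt_sq, ← wt_add hξ0, hτ]
        ring_nf
  calc _ ≤ ∑' j, ENNReal.ofReal (2 ^ |a| * (L * M)) ^ 2 *
        ∫⁻ ξ in annulus j, wt (2 * τ) ξ * V ξ ^ 2 := ENNReal.tsum_le_tsum key
    _ = ENNReal.ofReal (2 ^ |a| * (L * M)) ^ 2 *
        ∑' j, ∫⁻ ξ in annulus j, wt (2 * τ) ξ * V ξ ^ 2 := ENNReal.tsum_mul_left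
    _ ≤ ENNReal.ofReal (2 ^ |a| * (L * M)) ^ 2 * (2 * ∫⁻ ξ, wt (2 * τ) ξ * V ξ ^ 2) := by
      gcongr
      exact tsum_annulus_le (by fun_prop)
    _ = _ := by ring

end LocCommutator

open LocCommutator in
theorem mainTheorem5 (φ : 𝓢(Plane, ℝ)) (hφ : IsLittlewoodPaley φ)
    (s ν ρ : ℝ) (hs : s ∈ Set.Ico (0 : ℝ) 1) (hν : ν ∈ Set.Ioo (0 : ℝ) 1) :
    ∃ C : ℝ≥0, 0 < C ∧
      ∀ (P : Plane → ℂ) (M : ℝ≥0), SymbolBound P M →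
      ∀ d : Plane → ℂ, (d = lamSymbol 1 ∨ ∃ l : Fin 2, d = partialSymbol l) →
      ∀ f g : 𝓢'(Plane, ℂ), Admissible s ν f g →
      ∃ c : ℤ → ℝ≥0, ∑' j, (c j : ℝ≥0∞) ^ 2 ≤ 1 ∧
        ∀ j : ℤ, ∃ K : 𝓢'(Plane, ℂ), IsCommutator (opSymbol φ (s + ρ) P d j) g f K ∧
          ∀ h : 𝓢'(Plane, ℂ), FourierSupportedIn h (annulus j) → MemHdot ρ h →
          ∃ z : ℂ, IsPairing K h z ∧
            ‖z‖ₑ ≤ C * M * c j *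
              min (hdotNorm (1 - ν) f * hdotNorm (s + 1) g)
                (hdotNorm s f * hdotNorm (2 - ν) g) * hdotNorm (ρ + ν) h ∧
            ‖z‖ₑ ≤ C * M * c j *
              min ((fourierNorm 1 0 f + hdotNorm 1 f) * hdotNorm (s + 1) g)
                ((fourierNorm 1 1 g + hdotNorm 2 g) * hdotNorm s f) * hdotNorm ρ h := by
  obtain ⟨L, hL⟩ := exists_lipschitz_opSymbol hφ (s + ρ)
  obtain ⟨C₀, hC₀⟩ := exists_lintegral_cv_le hs hν
  set C₁ : ℝ≥0 := Real.toNNReal (2 ^ |s + ρ|) * L * (2 * C₀ + 1) with hC₁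
  refine ⟨2 * C₁ + 1, by positivity, fun P M hP d hd f g hfg => ?_⟩
  obtain ⟨⟨F, mF, hF, hF2⟩, w, mw, hw, hw12, v, hvw, hv⟩ := hfg.exists_represents hs.1 hν.2.le
  set V := cv (fun η => ‖F η‖ₑ) (fun η => wt 1 η * ‖w η‖ₑ) with hV
  have mV : Measurable V := measurable_cv (by fun_prop) (by fun_prop)
  have hcomm : ∀ j, ∃ (K : 𝓢'(Plane, ℂ)) (κ : Plane → ℂ),
      IsCommutator (opSymbol φ (s + ρ) P d j) g f K ∧ Measurable κ ∧ MemLp κ 2 ∧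
      Represents κ (𝓕 K) ∧ ∀ᵐ ξ ∂(volume.restrict (annulus j)),
        ‖κ ξ‖ₑ ≤ ENNReal.ofReal (L * M * ((2 : ℝ) ^ j) ^ (s + ρ)) * V ξ := by
    intro j
    have hlip := hL P M hP d hd j
    set m := opSymbol φ (s + ρ) P d j
    set Λ : ℝ := L * M * ((2 : ℝ) ^ j) ^ (s + ρ)
    have hΛ : 0 ≤ Λ := by positivity
    have hm0 : ∀ ξ ∉ annulus j, m ξ = 0 := fun ξ hξ => opSymbol_eq_zero hφ _ _ _ hξ
    have hcont : Continuous m :=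
      (LipschitzWith.of_dist_le_mul (K := ⟨Λ, hΛ⟩) fun x y => by
        rw [dist_eq_norm, dist_eq_norm]; exact hlip x y).continuous
    have hbd : ∀ ξ, ‖m ξ‖ₑ ≤ (Real.toNNReal (Λ * 2 ^ (j + 1)) : ℝ≥0∞) := by
      intro ξ
      by_cases hξ : ξ ∈ annulus j
      · rw [← ofReal_norm]
        refine ENNReal.ofReal_le_ofReal ?_
        have h0 : m 0 = 0 := hm0 0 fun h => ne_zero_of_mem_annulus h rfl
        have h1 := hlip ξ 0
        rw [h0, sub_zero, sub_zero] at h1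
        refine h1.trans ?_
        gcongr
        exact hξ.2.le
      · rw [hm0 ξ hξ]; simp
    obtain ⟨K, κ, hK, mκ, hκ2, hκ, hb⟩ := exists_isCommutator (f := f) (g := g)
      hcont.measurable hbd (measurableSet_annulus j) (volume_annulus_lt_top j) hm0 mF hF hF2 mw hw
      hw12 hvw hv
    refine ⟨K, κ, hK, mκ, hκ2, hκ, ?_⟩
    filter_upwards [hb] with ξ hξ
    refine hξ.trans ?_
    rw [hV, cv, ← lintegral_const_mul _ (by fun_prop)]
    refine lintegral_mono fun η => ?_
    have h1 : ‖m ξ - m (ξ - η)‖ₑ ≤ ENNReal.ofReal Λ * wt 1 η := by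
      rw [wt, Real.rpow_one, ← ENNReal.ofReal_mul hΛ, ← ofReal_norm]
      refine ENNReal.ofReal_le_ofReal ?_
      simpa using hlip ξ (ξ - η)
    calc _ ≤ (ENNReal.ofReal Λ * wt 1 η) * (‖F (ξ - η)‖ₑ * ‖w η‖ₑ) := by gcongr
      _ = _ := by ring
  choose K κ hK mκ hκ2 hκ hb using hcomm
  obtain ⟨hV₁, hV₂⟩ := hC₀ f g F w mF mw hF hw
  set X₁ := min (hdotNorm (1 - ν) f * hdotNorm (s + 1) g) (hdotNorm s f * hdotNorm (2 - ν) g)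
  set X₂ := min ((fourierNorm 1 0 f + hdotNorm 1 f) * hdotNorm (s + 1) g)
    ((fourierNorm 1 1 g + hdotNorm 2 g) * hdotNorm s f)
  have hconst : 2 * ENNReal.ofReal (2 ^ |s + ρ| * (L * M)) ^ 2 * C₀ ≤
      ((C₁ * M : ℝ≥0) : ℝ≥0∞) ^ 2 := by
    rw [ENNReal.ofReal, Real.toNNReal_mul (by positivity), Real.toNNReal_mul (by positivity),
      Real.toNNReal_coe, Real.toNNReal_coe]
    norm_cast
    rw [hC₁]
    set B := Real.toNNReal (2 ^ |s + ρ|)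
    calc 2 * (B * (L * M)) ^ 2 * C₀ = (B * L * M) ^ 2 * (2 * C₀) := by ring
      _ ≤ (B * L * M) ^ 2 * (2 * C₀ + 1) ^ 2 := by
        gcongr
        exact le_self_add.trans (le_self_pow le_add_self two_ne_zero)
      _ = _ := by ring
  have hsum : ∀ {σ τ : ℝ} {X : ℝ≥0∞}, τ = s + ρ - σ → ∫⁻ ξ, wt (2 * τ) ξ * V ξ ^ 2 ≤ C₀ * X ^ 2 →
      ∑' j, ∫⁻ ξ in annulus j, wt (-(2 * σ)) ξ * ‖κ j ξ‖ₑ ^ 2 ≤ ((C₁ * M : ℝ≥0) * X) ^ 2 := by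
    intro σ τ X hτ hX
    calc _ ≤ _ := tsum_setLIntegral_le (by positivity) mV σ hτ hb
      _ ≤ 2 * ENNReal.ofReal (2 ^ |s + ρ| * (L * M)) ^ 2 * (C₀ * X ^ 2) := by gcongr
      _ = 2 * ENNReal.ofReal (2 ^ |s + ρ| * (L * M)) ^ 2 * C₀ * X ^ 2 := by ring
      _ ≤ _ := by rw [mul_pow]; gcongr
  obtain ⟨c₁, hc₁, hD₁⟩ := exists_seq_of_tsum_le (hsum (σ := ρ + ν) (by ring) hV₁)
  obtain ⟨c₂, hc₂, hD₂⟩ := exists_seq_of_tsum_le (hsum (σ := ρ) (by ring) hV₂)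
  have final : ∀ {σ : ℝ} {X : ℝ≥0∞} {j : ℤ} {c c' : ℝ≥0} {z : ℂ} {h : 𝓢'(Plane, ℂ)}, c ≤ 2 * c' →
      ∫⁻ ξ in annulus j, wt (-(2 * σ)) ξ * ‖κ j ξ‖ₑ ^ 2 ≤
        ((C₁ * M : ℝ≥0) * X) ^ 2 * (c : ℝ≥0∞) ^ 2 →
      ‖z‖ₑ ^ 2 ≤ (∫⁻ ξ in annulus j, wt (-(2 * σ)) ξ * ‖κ j ξ‖ₑ ^ 2) * hdotNorm σ h ^ 2 →
      ‖z‖ₑ ≤ (2 * C₁ + 1 : ℝ≥0) * M * c' * X * hdotNorm σ h := by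
    intro σ X j c c' z h hc hD hz
    refine le_of_sq_le_sq (hz.trans ?_)
    calc _ ≤ ((C₁ * M : ℝ≥0) * X) ^ 2 * (c : ℝ≥0∞) ^ 2 * hdotNorm σ h ^ 2 := by gcongr
      _ = ((C₁ * M * c : ℝ≥0) * X * hdotNorm σ h) ^ 2 := by push_cast; ring
      _ ≤ _ := by
        have hk : C₁ * M * c ≤ (2 * C₁ + 1) * M * c' := by
          calc C₁ * M * c ≤ C₁ * M * (2 * c') := by gcongr
            _ = 2 * C₁ * M * c' := by ring
            _ ≤ _ := by gcongr; exact le_self_add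
        rw [← ENNReal.coe_mul, ← ENNReal.coe_mul]
        exact pow_le_pow_left'
          (mul_le_mul' (mul_le_mul' (ENNReal.coe_le_coe.2 hk) le_rfl) le_rfl) 2
  refine ⟨fun j => (c₁ j + c₂ j) / 2, ?_, fun j => ⟨K j, hK j, fun h hsupp hh => ?_⟩⟩
  · have h1 : ∀ j, (((c₁ j + c₂ j) / 2 : ℝ≥0) : ℝ≥0∞) ^ 2 ≤
        ((1 / 2 : ℝ≥0) : ℝ≥0∞) * ((c₁ j : ℝ≥0∞) ^ 2 + (c₂ j : ℝ≥0∞) ^ 2) := by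
      intro j
      norm_cast
      rw [← NNReal.coe_le_coe]
      push_cast
      nlinarith [sq_nonneg ((c₁ j : ℝ) - c₂ j)]
    calc _ ≤ _ := ENNReal.tsum_le_tsum h1
      _ = ((1 / 2 : ℝ≥0) : ℝ≥0∞) *
          (∑' j, (c₁ j : ℝ≥0∞) ^ 2 + ∑' j, (c₂ j : ℝ≥0∞) ^ 2) := by
        rw [ENNReal.tsum_mul_left, ENNReal.tsum_add]
      _ ≤ ((1 / 2 : ℝ≥0) : ℝ≥0∞) * (1 + 1) := by gcongr
      _ = 1 := by
        norm_cast
        norm_num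
  · obtain ⟨z, hz, hzb⟩ := exists_isPairing (mκ j) (hκ2 j) (hκ j) hsupp hh
    refine ⟨z, hz, final ?_ (hD₁ j) (hzb _), final ?_ (hD₂ j) (hzb _)⟩
    · rw [mul_div_cancel₀ _ two_ne_zero]; exact le_self_add
    · rw [mul_div_cancel₀ _ two_ne_zero]; exact le_add_self
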